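/- **Definitions.** A linear permutation $\pi=\pi_1\cdots\pi_n$ of length $|\pi|=n\ge 0$ is a sequence of $n$ distinct positive integers; $[\pi]$ denotes its class under cyclic rotation, called a cyclic permutation of length $n$. Put $\operatorname{cdes}[\pi]=|\{i\in[n] : \pi_i>\pi_{i+1}\}|$, with indices modulo $n$. For $\pi,\sigma$ with no letters in common, the set $[\pi]⧢[\sigma]$ of cyclic shuffles consists of all $[\tau]$ such that $\tau$ is a linear permutation of length $|\pi|+|\sigma|$ having some rotation of $\pi$ and some rotation of $\sigma$ as subsequences. The statistic $\operatorname{cdes}$ is *cyclic shuffle-compatible* if the multiset $\{\{\operatorname{cdes}[\tau] : [\tau]\in[\pi]⧢[\sigma]\}\}$, for disjoint $\pi,\sigma$, depends only on $\operatorname{cdes}[\pi]$, $\operatorname{cdes}[\sigma]$, $|\pi|$ and $|\sigma|$. Let $[\pi]_{\operatorname{cdes}}$ be the set of cyclic permutations with the same length and the same $\operatorname{cdes}$ as $[\pi]$. When $\operatorname{cdes}$ is cyclic shuffle-compatible, its *cyclic shuffle algebra* $\mathcal A^{\mathrm{cyc}}_{\operatorname{cdes}}$ is the $\mathbb Q$-algebra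 with these classes as a basis and with multiplication $[\pi]_{\operatorname{cdes}}[\sigma]_{\operatorname{cdes}}=\sum_{[\tau]\in[\pi]⧢[\sigma]}[\tau]_{\operatorname{cdes}}$ for disjoint $\pi,\sigma$; its $n$th homogeneous component is spanned by the classes of cyclic permutations of length $n$. Let $\mathbb Q[[t*]]$ be the algebra of formal power series over $\mathbb Q$ in $t$ with the Hadamard (coefficientwise) product, and $\mathbb Q[x]^{\mathbb N}$ the algebra of functions of $p\in\mathbb N=\{0,1,2,\dots\}$ with values in $\mathbb Q[x]$ and pointwise operations. (Products and quotients of power series written inside a single expression below are the ordinary ones.) **Theorem 4.8.** (a) The cyclic descent number $\operatorname{cdes}$ is cyclic shuffle-compatible. (b) The linear map on $\mathcal A^{\mathrm{cyc}}_{\operatorname{cdes}}$ defined by $$[\pi]_{\operatorname{cdes}}\mapsto\begin{cases}\dfrac{\operatorname{cdes}[\pi]\,t^{\operatorname{cdes}[\pi]}+(|\pi|-\operatorname{cdes}[\pi])\,t^{\operatorname{cdes}[\pi]+1}}{(1-t)^{|\pi|+1}}\,x^{|\pi|},&|\pi|\ge1,\\[2mm] \dfrac1{1-t},&|\pi|=0,\end{cases}$$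 is a $\mathbb Q$-algebra isomorphism from $\mathcal A^{\mathrm{cyc}}_{\operatorname{cdes}}$ to the span of $$\left\{\frac1{1-t},\ \frac{tx}{(1-t)^2}\right\}\cup\left\{\frac{kt^k+(n-k)t^{k+1}}{(1-t)^{n+1}}x^n\right\}_{n\ge2,\ 1\le k\le n-1},$$ a subalgebra of $\mathbb Q[[t*]][x]$. (c) The linear map on $\mathcal A^{\mathrm{cyc}}_{\operatorname{cdes}}$ defined by $$[\pi]_{\operatorname{cdes}}\mapsto\begin{cases}\dbinom{p+|\pi|-\operatorname{cdes}[\pi]-1}{|\pi|-1}\,p\,x^{|\pi|},&|\pi|\ge1,\\[2mm] 1,&|\pi|=0,\end{cases}$$ is a $\mathbb Q$-algebra isomorphism from $\mathcal A^{\mathrm{cyc}}_{\operatorname{cdes}}$ to the span of $$\{1,\ px\}\cup\left\{\binom{p+n-k-1}{n-1}\,p\,x^n\right\}_{n\ge2,\ 1\le k\le n-1},$$ a subalgebra of $\mathbb Q[x]^{\mathbb N}$. (d) For all $n\ge2$, the $n$th homogeneous component of $\mathcal A^{\mathrm{cyc}}_{\operatorname{cdes}}$ has dimension $n-1$. -/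

import Mathlib

noncomputable section

namespace CyclicShuffle

/-- A linear permutation is a list of distinct letters in the positive integers.  A cyclic
permutation `[π]` is the class of a linear permutation under rotation; `Cycle ℕ+` is the quotient
of `List ℕ+` by rotation. -/
abbrev CyclicPerm : Type := {c : Cycle ℕ+ // c.Nodup}

/-- The cyclic permutation `[π]` of a linear permutation `π`. -/
def CyclicPerm.of (π : List ℕ+) (h : π.Nodup) : CyclicPerm := ⟨(π : Cycle ℕ+), h⟩

/-- The length of a cyclic permutation. -/
def CyclicPerm.length (π : CyclicPerm) : ℕ := π.1.length

/-- The set of letters of a cyclic permutation. -/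
def CyclicPerm.letters (π : CyclicPerm) : Finset ℕ+ := π.1.toFinset

/-- The standardization of a linear permutation: the smallest letter is replaced by 1, the second
smallest by 2, and so on. -/
def standardization (π : List ℕ+) : List ℕ := π.map fun x => π.countP (fun y => decide (y ≤ x))

/-- A cyclic permutation statistic: a function on cyclic permutations with `cst [π] = cst [σ]`
whenever `π` and `σ` have the same relative order (i.e. the same standardization). -/
structure CyclicStatistic (α : Type*) where
  toFun : CyclicPerm → α
  eq_of_same_order : ∀ (π σ : List ℕ+) (hπ : π.Nodup) (hσ : σ.Nodup),
    standardization π = standardization σ →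
      toFun (CyclicPerm.of π hπ) = toFun (CyclicPerm.of σ hσ)

instance {α : Type*} : CoeFun (CyclicStatistic α) (fun _ => CyclicPerm → α) :=
  ⟨CyclicStatistic.toFun⟩

/-! ### Shuffles -/

/-- `τ` is a shuffle of the (disjoint) linear permutations `π` and `σ`: it is a linear permutation
of length `|π| + |σ|` of which `π` and `σ` are subsequences. -/
def IsShuffle (τ π σ : List ℕ+) : Prop :=
  τ.Nodup ∧ τ.length = π.length + σ.length ∧ π.Sublist τ ∧ σ.Sublist τ

/-- The set `[π] ⧢ [σ]` of cyclic shuffles of disjoint cyclic permutations (empty if they are not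
disjoint). -/
def cyclicShuffleSet (π σ : CyclicPerm) : Set CyclicPerm :=
  {κ | Disjoint π.letters σ.letters ∧
    ∃ p s t : List ℕ+, (p : Cycle ℕ+) = π.1 ∧ (s : Cycle ℕ+) = σ.1 ∧ (t : Cycle ℕ+) = κ.1 ∧
      IsShuffle t p s}

/-- The restriction of a cycle to the letters in a finite set. -/
def restrictCycle (S : Finset ℕ+) : Cycle ℕ+ → Cycle ℕ+ :=
  Quotient.map (fun l => l.filter (fun x => decide (x ∈ S))) (by
    rintro l l' ⟨n, rfl⟩
    change (l.filter _).IsRotated ((l.rotate n).filter _)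
    rw [List.rotate_eq_drop_append_take_mod]
    conv_lhs => rw [← List.take_append_drop (n % l.length) l]
    rw [List.filter_append, List.filter_append]
    exact List.isRotated_append)

theorem restrictCycle_coe (S : Finset ℕ+) (l : List ℕ+) :
    restrictCycle S (l : Cycle ℕ+) = (l.filter (fun x => decide (x ∈ S)) : List ℕ+) := rfl

theorem restrictCycle_nodup (S : Finset ℕ+) (c : Cycle ℕ+) (h : c.Nodup) :
    (restrictCycle S c).Nodup := by
  induction c using Quotient.inductionOn with
  | _ l => exact List.Nodup.filter _ (show l.Nodup from h)

theorem restrictCycle_toFinset (S : Finset ℕ+) (c : Cycle ℕ+) :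
    (restrictCycle S c).toFinset = c.toFinset ∩ S := by
  induction c using Quotient.inductionOn with
  | _ l =>
    change (l.filter _).toFinset = l.toFinset ∩ S
    ext x; simp

theorem restrictCycle_restrictCycle (S T : Finset ℕ+) (c : Cycle ℕ+) (h : T ⊆ S) :
    restrictCycle T (restrictCycle S c) = restrictCycle T c := by
  induction c using Quotient.inductionOn with
  | _ l =>
    change ((List.filter _ (List.filter _ l) : List ℕ+) : Cycle ℕ+) = (List.filter _ l : List ℕ+)
    rw [List.filter_filter]
    congr 1
    apply List.filter_congr
    intro x _
    by_cases hx : x ∈ T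
    · simp [hx, h hx]
    · simp [hx]

theorem restrictCycle_self (S : Finset ℕ+) (c : Cycle ℕ+) (h : c.toFinset ⊆ S) :
    restrictCycle S c = c := by
  induction c using Quotient.inductionOn with
  | _ l =>
    change ((List.filter _ l : List ℕ+) : Cycle ℕ+) = (l : Cycle ℕ+)
    rw [List.filter_eq_self.2]
    intro x hx
    have : x ∈ l.toFinset := by simpa using hx
    simpa using h this

theorem length_eq_card (π : CyclicPerm) : π.length = π.letters.card := by
  obtain ⟨c, hc⟩ := π
  induction c using Quotient.inductionOn with
  | _ l => exact (List.toFinset_card_of_nodup (show l.Nodup from hc)).symm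

theorem filter_eq_of_sublist {p t : List ℕ+} (ht : t.Nodup) (h : p.Sublist t) :
    t.filter (fun x => decide (x ∈ p.toFinset)) = p := by
  symm
  have h1 : p.Sublist (t.filter (fun x => decide (x ∈ p.toFinset))) := by
    have := h.filter (fun x => decide (x ∈ p.toFinset))
    rwa [List.filter_eq_self.2 (by intro x hx; simpa using hx)] at this
  apply h1.eq_of_length_le
  apply List.Subperm.length_le
  apply List.subperm_of_subset (ht.filter _)
  intro x hx
  simpa using (List.mem_filter.1 hx).2

theorem mem_cyclicShuffleSet {π σ κ : CyclicPerm} :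
    κ ∈ cyclicShuffleSet π σ ↔ Disjoint π.letters σ.letters ∧
      κ.letters = π.letters ∪ σ.letters ∧
      restrictCycle π.letters κ.1 = π.1 ∧ restrictCycle σ.letters κ.1 = σ.1 := by
  refine and_congr_right fun hd => ?_
  constructor
  · rintro ⟨p, s, t, hp, hs, ht, hnd, hlen, h1, h2⟩
    have hpL : π.letters = p.toFinset := by rw [CyclicPerm.letters, ← hp]; rfl
    have hsL : σ.letters = s.toFinset := by rw [CyclicPerm.letters, ← hs]; rfl
    have htL : κ.letters = t.toFinset := by rw [CyclicPerm.letters, ← ht]; rfl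
    refine ⟨?_, ?_, ?_⟩
    · symm
      apply Finset.eq_of_subset_of_card_le
      · rw [hpL, hsL, htL]
        intro x hx
        simp only [Finset.mem_union, List.mem_toFinset] at hx ⊢
        exact hx.elim (fun h => h1.subset h) (fun h => h2.subset h)
      · rw [Finset.card_union_of_disjoint hd, hpL, hsL, htL, List.toFinset_card_of_nodup hnd,
          List.toFinset_card_of_nodup (hnd.sublist h1),
          List.toFinset_card_of_nodup (hnd.sublist h2), hlen]
    · rw [← ht, restrictCycle_coe, hpL, filter_eq_of_sublist hnd h1, hp]
    · rw [← ht, restrictCycle_coe, hsL, filter_eq_of_sublist hnd h2, hs]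
  · rintro ⟨hU, h1, h2⟩
    obtain ⟨t, ht⟩ : ∃ t : List ℕ+, (t : Cycle ℕ+) = κ.1 := Quotient.exists_rep κ.1
    have hnd : t.Nodup := by
      have := κ.2
      rw [← ht] at this
      exact this
    have hlen := length_eq_card κ
    rw [hU, Finset.card_union_of_disjoint hd, ← length_eq_card, ← length_eq_card] at hlen
    rw [← ht, restrictCycle_coe] at h1 h2
    refine ⟨_, _, t, h1, h2, ht, hnd, ?_, List.filter_sublist, List.filter_sublist⟩
    simp only [CyclicPerm.length] at hlen
    rw [← ht, ← h1, ← h2] at hlen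
    exact hlen

theorem cyclicShuffleSet_finite (π σ : CyclicPerm) : (cyclicShuffleSet π σ).Finite := by
  have hfin : {l : List ℕ+ | l ∈ (π.letters ∪ σ.letters).toList.permutations}.Finite :=
    List.finite_toSet _
  refine Set.Finite.of_finite_image (f := Subtype.val) ?_ Subtype.val_injective.injOn
  refine (Set.Finite.image (fun l : List ℕ+ => (l : Cycle ℕ+)) hfin).subset ?_
  rintro _ ⟨κ, hκ, rfl⟩
  have hU := (mem_cyclicShuffleSet.1 hκ).2.1
  obtain ⟨t, ht⟩ : ∃ t : List ℕ+, (t : Cycle ℕ+) = κ.1 := Quotient.exists_rep κ.1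
  have hnd : t.Nodup := by
    have := κ.2
    rw [← ht] at this
    exact this
  refine ⟨t, ?_, ht⟩
  have htL : κ.letters = t.toFinset := by rw [CyclicPerm.letters, ← ht]; rfl
  rw [Set.mem_ofPred_eq, List.mem_permutations, List.perm_ext_iff_of_nodup hnd (Finset.nodup_toList _)]
  intro x
  rw [Finset.mem_toList, ← hU, htL, List.mem_toFinset]

/-- The finite set `[π] ⧢ [σ]` of cyclic shuffles. -/
def cyclicShuffles (π σ : CyclicPerm) : Finset CyclicPerm := (cyclicShuffleSet_finite π σ).toFinset

theorem mem_cyclicShuffles {π σ κ : CyclicPerm} :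
    κ ∈ cyclicShuffles π σ ↔ Disjoint π.letters σ.letters ∧
      κ.letters = π.letters ∪ σ.letters ∧
      restrictCycle π.letters κ.1 = π.1 ∧ restrictCycle σ.letters κ.1 = σ.1 := by
  rw [cyclicShuffles, Set.Finite.mem_toFinset, mem_cyclicShuffleSet]

variable {α : Type*}

/-- The distribution (multiset of values) of a statistic over a finite set of cyclic
permutations. -/
def CyclicStatistic.distribution (cst : CyclicStatistic α) (S : Finset CyclicPerm) : Multiset α :=
  S.val.map cst

/-- Cyclic shuffle-compatibility: the distribution of `cst` over `[π] ⧢ [σ]`, for disjoint `π` and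
`σ`, depends only on `cst [π]`, `cst [σ]` and the two lengths. -/
def CyclicStatistic.IsCyclicShuffleCompatible (cst : CyclicStatistic α) : Prop :=
  ∀ π π' σ σ' : CyclicPerm, Disjoint π.letters σ.letters → Disjoint π'.letters σ'.letters →
    cst π = cst π' → cst σ = cst σ' → π.length = π'.length → σ.length = σ'.length →
    cst.distribution (cyclicShuffles π σ) = cst.distribution (cyclicShuffles π' σ')

/-! ### The cyclic shuffle algebra -/

/-- `cst`-equivalence of cyclic permutations: same length and same value of `cst`. -/
def CyclicStatistic.setoid (cst : CyclicStatistic α) : Setoid CyclicPerm where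
  r π σ := cst π = cst σ ∧ π.length = σ.length
  iseqv := ⟨fun _ => ⟨rfl, rfl⟩, fun h => ⟨h.1.symm, h.2.symm⟩,
    fun h h' => ⟨h.1.trans h'.1, h.2.trans h'.2⟩⟩

/-- The set of `cst`-equivalence classes. -/
def CyclicStatistic.EqClass (cst : CyclicStatistic α) : Type := Quotient cst.setoid

/-- The `cst`-equivalence class of a cyclic permutation. -/
def CyclicStatistic.mkClass (cst : CyclicStatistic α) (π : CyclicPerm) : cst.EqClass :=
  Quotient.mk cst.setoid π

theorem CyclicStatistic.mkClass_eq {cst : CyclicStatistic α} {π σ : CyclicPerm} :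
    cst.mkClass π = cst.mkClass σ ↔ cst π = cst σ ∧ π.length = σ.length :=
  Quotient.eq (r := cst.setoid)

theorem CyclicStatistic.exists_mkClass (cst : CyclicStatistic α) (a : cst.EqClass) :
    ∃ π, cst.mkClass π = a := Quotient.exists_rep a

/-- Every equivalence class has a representative avoiding any given finite set of letters. -/
theorem CyclicStatistic.exists_rep_disjoint (cst : CyclicStatistic α) (a : cst.EqClass)
    (U : Finset ℕ+) : ∃ π, cst.mkClass π = a ∧ Disjoint U π.letters := by
  obtain ⟨⟨c, hc⟩, rfl⟩ := cst.exists_mkClass a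
  obtain ⟨l, rfl⟩ : ∃ l : List ℕ+, (l : Cycle ℕ+) = c := Quotient.exists_rep c
  obtain ⟨N, hN⟩ : ∃ N : ℕ+, ∀ x ∈ U, x ≤ N := U.exists_le
  have hinj : Function.Injective (fun x : ℕ+ => x + N) := add_left_injective N
  have hnd : (l.map (fun x => x + N)).Nodup := List.Nodup.map hinj hc
  refine ⟨CyclicPerm.of _ hnd, ?_, ?_⟩
  · rw [CyclicStatistic.mkClass_eq]
    refine ⟨cst.eq_of_same_order _ _ hnd hc ?_, ?_⟩
    · simp only [standardization, List.map_map, List.countP_map]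
      apply List.map_congr_left
      intro x _
      simp [Function.comp_def]
    · exact List.length_map _
  · rw [Finset.disjoint_left]
    intro x hx hx'
    have : x ∈ l.map (fun x => x + N) := List.mem_toFinset.1 hx'
    obtain ⟨y, _, rfl⟩ := List.mem_map.1 this
    exact absurd (hN _ hx) (not_le.2 (PNat.lt_add_left N y))

theorem CyclicStatistic.exists_disjoint_reps (cst : CyclicStatistic α) (a b : cst.EqClass) :
    ∃ q : CyclicPerm × CyclicPerm, cst.mkClass q.1 = a ∧ cst.mkClass q.2 = b ∧
      Disjoint q.1.letters q.2.letters := by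
  obtain ⟨π, hπ⟩ := cst.exists_mkClass a
  obtain ⟨σ, hσ, h⟩ := cst.exists_rep_disjoint b π.letters
  exact ⟨(π, σ), hπ, hσ, h⟩

/-- The cyclic shuffle algebra of a cyclic shuffle-compatible statistic: as a rational vector space
it has the `cst`-equivalence classes as a basis. -/
def CyclicShuffleAlgebra (cst : CyclicStatistic α) (_h : cst.IsCyclicShuffleCompatible) : Type :=
  cst.EqClass →₀ ℚ

namespace CyclicShuffleAlgebra

variable {cst : CyclicStatistic α} {h : cst.IsCyclicShuffleCompatible}

instance : AddCommGroup (CyclicShuffleAlgebra cst h) :=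
  inferInstanceAs (AddCommGroup (cst.EqClass →₀ ℚ))

instance : Module ℚ (CyclicShuffleAlgebra cst h) :=
  inferInstanceAs (Module ℚ (cst.EqClass →₀ ℚ))

/-- The basis element of the cyclic shuffle algebra given by an equivalence class. -/
def single (h : cst.IsCyclicShuffleCompatible) (a : cst.EqClass) : CyclicShuffleAlgebra cst h :=
  Finsupp.single a 1

/-- The basis element `[π]_cst` of the cyclic shuffle algebra. -/
def cls (h : cst.IsCyclicShuffleCompatible) (π : CyclicPerm) : CyclicShuffleAlgebra cst h :=
  single h (cst.mkClass π)

/-- The basis of equivalence classes. -/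
def basis (h : cst.IsCyclicShuffleCompatible) :
    Module.Basis cst.EqClass ℚ (CyclicShuffleAlgebra cst h) :=
  Module.Basis.ofRepr (LinearEquiv.refl ℚ (cst.EqClass →₀ ℚ))

theorem basis_apply (a : cst.EqClass) : basis h a = single h a := rfl

/-- The product of two basis elements, computed from disjoint representatives; by `cls_mul_cls`
below it does not depend on them. -/
def mulBasis (h : cst.IsCyclicShuffleCompatible) (a b : cst.EqClass) :
    CyclicShuffleAlgebra cst h :=
  ∑ κ ∈ cyclicShuffles (cst.exists_disjoint_reps a b).choose.1
    (cst.exists_disjoint_reps a b).choose.2, cls h κ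

/-- The multiplication, extended bilinearly from the basis. -/
def mulLin (h : cst.IsCyclicShuffleCompatible) :
    CyclicShuffleAlgebra cst h →ₗ[ℚ] CyclicShuffleAlgebra cst h →ₗ[ℚ] CyclicShuffleAlgebra cst h :=
  (basis h).constr ℚ fun a => (basis h).constr ℚ fun b => mulBasis h a b

instance : Mul (CyclicShuffleAlgebra cst h) := ⟨fun x y => mulLin h x y⟩

/-- The unit is the class of the empty cyclic permutation. -/
instance : One (CyclicShuffleAlgebra cst h) := ⟨cls h (CyclicPerm.of [] List.nodup_nil)⟩

theorem mul_def (x y : CyclicShuffleAlgebra cst h) : x * y = mulLin h x y := rfl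

theorem one_def : (1 : CyclicShuffleAlgebra cst h) = cls h (CyclicPerm.of [] List.nodup_nil) := rfl

theorem single_mul_single (a b : cst.EqClass) : single h a * single h b = mulBasis h a b := by
  rw [mul_def, mulLin, ← basis_apply, ← basis_apply, Module.Basis.constr_basis,
    Module.Basis.constr_basis]

theorem length_of_mem {π σ κ : CyclicPerm} (hκ : κ ∈ cyclicShuffles π σ) :
    κ.length = π.length + σ.length := by
  obtain ⟨hd, hU, -⟩ := mem_cyclicShuffles.1 hκ
  rw [length_eq_card, hU, Finset.card_union_of_disjoint hd, length_eq_card, length_eq_card]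

/-- The multiplication rule: `[π]_cst [σ]_cst` is the sum of the `[τ]_cst` over the cyclic shuffles
`[τ]` of `[π]` and `[σ]`, for any disjoint representatives. -/
theorem cls_mul_cls (π σ : CyclicPerm) (hd : Disjoint π.letters σ.letters) :
    cls h π * cls h σ = ∑ κ ∈ cyclicShuffles π σ, cls h κ := by
  rw [cls, cls, single_mul_single, mulBasis]
  obtain ⟨h1, h2, h3⟩ := (cst.exists_disjoint_reps (cst.mkClass π) (cst.mkClass σ)).choose_spec
  generalize (cst.exists_disjoint_reps (cst.mkClass π) (cst.mkClass σ)).choose = q at h1 h2 h3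
  obtain ⟨π', σ'⟩ := q
  rw [CyclicStatistic.mkClass_eq] at h1 h2
  have key := h π' π σ' σ h3 hd h1.1 h2.1 h1.2 h2.2
  have rep : ∀ κ₀ : CyclicPerm, ∀ ρ θ : CyclicPerm, κ₀.length = ρ.length + θ.length →
      ∑ κ ∈ cyclicShuffles ρ θ, cls h κ =
        ((cst.distribution (cyclicShuffles ρ θ)).map (fun v =>
          (open Classical in if hv : ∃ κ : CyclicPerm, κ.length = κ₀.length ∧ cst κ = v then
            cls h hv.choose else 0))).sum := by
    intro κ₀ ρ θ hl
    rw [CyclicStatistic.distribution, Multiset.map_map]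
    refine Finset.sum_congr rfl fun κ hκ => ?_
    have hv : ∃ κ' : CyclicPerm, κ'.length = κ₀.length ∧ cst κ' = cst κ :=
      ⟨κ, (length_of_mem hκ).trans hl.symm, rfl⟩
    simp only [Function.comp_apply]
    rw [dif_pos hv, cls, cls]
    congr 1
    rw [CyclicStatistic.mkClass_eq]
    exact ⟨hv.choose_spec.2.symm, by rw [hv.choose_spec.1, hl, length_of_mem hκ]⟩
  by_cases hne : (cyclicShuffles π' σ').Nonempty
  · obtain ⟨κ₀, hκ₀⟩ := hne
    have hl := length_of_mem hκ₀
    rw [rep κ₀ π' σ' hl, rep κ₀ π σ (hl.trans (by rw [h1.2, h2.2])), key]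
  · rw [Finset.not_nonempty_iff_eq_empty] at hne
    have h0 : cyclicShuffles π σ = ∅ := by
      rw [hne] at key
      simp only [CyclicStatistic.distribution] at key
      have : (cyclicShuffles π σ).val = 0 := by
        rw [← Multiset.map_eq_zero (f := cst.toFun)]
        exact key.symm.trans (by simp)
      exact Finset.val_eq_zero.1 this
    change ∑ κ ∈ cyclicShuffles π' σ', cls h κ = _
    rw [hne, h0]

theorem cyclicShuffles_comm (π σ : CyclicPerm) : cyclicShuffles π σ = cyclicShuffles σ π := by
  ext κ
  rw [mem_cyclicShuffles, mem_cyclicShuffles, disjoint_comm, Finset.union_comm,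
    and_comm (a := restrictCycle π.letters κ.1 = π.1)]

theorem cyclicShuffles_nil (σ : CyclicPerm) :
    cyclicShuffles (CyclicPerm.of [] List.nodup_nil) σ = {σ} := by
  have hnil : (CyclicPerm.of [] List.nodup_nil).letters = ∅ := rfl
  ext κ
  rw [mem_cyclicShuffles, hnil, Finset.empty_union, Finset.mem_singleton]
  constructor
  · rintro ⟨-, hU, -, h2⟩
    apply Subtype.ext
    rw [← h2, restrictCycle_self]
    exact hU.le
  · rintro rfl
    refine ⟨Finset.disjoint_empty_left _, rfl, ?_, restrictCycle_self _ _ le_rfl⟩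
    obtain ⟨t, ht⟩ : ∃ t : List ℕ+, (t : Cycle ℕ+) = κ.1 := Quotient.exists_rep κ.1
    rw [← ht, restrictCycle_coe]
    simp only [Finset.notMem_empty, decide_false, List.filter_false]
    rfl

/-- The cyclic permutation obtained by restricting to the letters in `S`. -/
def restrict (S : Finset ℕ+) (κ : CyclicPerm) : CyclicPerm :=
  ⟨restrictCycle S κ.1, restrictCycle_nodup S κ.1 κ.2⟩

theorem triple_aux {π σ τ ρ κ : CyclicPerm} (hdA : Disjoint π.letters σ.letters)
    (hρ : ρ ∈ cyclicShuffles σ τ) (hκ : κ ∈ cyclicShuffles π ρ) :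
    restrict (π.letters ∪ σ.letters) κ ∈ cyclicShuffles π σ ∧
    κ ∈ cyclicShuffles (restrict (π.letters ∪ σ.letters) κ) τ ∧
    restrict (σ.letters ∪ τ.letters) κ = ρ := by
  obtain ⟨hd1, hU1, h1, h2⟩ := mem_cyclicShuffles.1 hρ
  obtain ⟨hd2, hU2, h3, h4⟩ := mem_cyclicShuffles.1 hκ
  have hL : (restrict (π.letters ∪ σ.letters) κ).letters = π.letters ∪ σ.letters := by
    rw [CyclicPerm.letters, restrict, restrictCycle_toFinset]
    change κ.letters ∩ _ = _
    rw [hU2, hU1, Finset.inter_eq_right]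
    exact Finset.union_subset_union_right Finset.subset_union_left
  refine ⟨?_, ?_, ?_⟩
  · rw [mem_cyclicShuffles]
    refine ⟨hdA, hL, ?_, ?_⟩
    · rw [restrict, restrictCycle_restrictCycle _ _ _ Finset.subset_union_left, h3]
    · rw [restrict, restrictCycle_restrictCycle _ _ _ Finset.subset_union_right, ← h1, ← h4,
        restrictCycle_restrictCycle]
      rw [hU1]
      exact Finset.subset_union_left
  · rw [mem_cyclicShuffles, hL]
    refine ⟨?_, ?_, rfl, ?_⟩
    · rw [Finset.disjoint_union_left]
      refine ⟨?_, hd1⟩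
      rw [hU1] at hd2
      exact Finset.disjoint_of_subset_right Finset.subset_union_right hd2
    · rw [hU2, hU1, Finset.union_assoc]
    · rw [← h2, ← h4, restrictCycle_restrictCycle]
      rw [hU1]
      exact Finset.subset_union_right
  · apply Subtype.ext
    rw [← hU1]
    exact h4

theorem cls_mul_assoc (π σ τ : CyclicPerm) (h1 : Disjoint π.letters σ.letters)
    (h2 : Disjoint (π.letters ∪ σ.letters) τ.letters) :
    cls h π * cls h σ * cls h τ = cls h π * (cls h σ * cls h τ) := by
  rw [Finset.disjoint_union_left] at h2
  rw [cls_mul_cls π σ h1, cls_mul_cls σ τ h2.2]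
  simp only [mul_def, map_sum, LinearMap.sum_apply]
  simp only [← mul_def]
  have e1 : ∀ ρ ∈ cyclicShuffles π σ, cls h ρ * cls h τ = ∑ κ ∈ cyclicShuffles ρ τ, cls h κ := by
    intro ρ hρ
    refine cls_mul_cls _ _ ?_
    rw [(mem_cyclicShuffles.1 hρ).2.1, Finset.disjoint_union_left]
    exact h2
  have e2 : ∀ ρ ∈ cyclicShuffles σ τ, cls h π * cls h ρ = ∑ κ ∈ cyclicShuffles π ρ, cls h κ := by
    intro ρ hρ
    refine cls_mul_cls _ _ ?_
    rw [(mem_cyclicShuffles.1 hρ).2.1, Finset.disjoint_union_right]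
    exact ⟨h1, h2.1⟩
  rw [Finset.sum_congr rfl e1, Finset.sum_congr rfl e2, Finset.sum_sigma', Finset.sum_sigma']
  have back : ∀ {ρ κ : CyclicPerm}, ρ ∈ cyclicShuffles π σ → κ ∈ cyclicShuffles ρ τ →
      restrict (σ.letters ∪ τ.letters) κ ∈ cyclicShuffles σ τ ∧
      κ ∈ cyclicShuffles π (restrict (σ.letters ∪ τ.letters) κ) ∧
      restrict (π.letters ∪ σ.letters) κ = ρ := by
    intro ρ κ hρ hκ
    rw [cyclicShuffles_comm] at hρ hκ
    obtain ⟨a, b, c⟩ := triple_aux h2.2.symm hρ hκ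
    rw [Finset.union_comm τ.letters] at a b
    rw [Finset.union_comm σ.letters] at c
    rw [cyclicShuffles_comm] at a b
    exact ⟨a, b, c⟩
  refine Finset.sum_nbij' (fun x => ⟨restrict (σ.letters ∪ τ.letters) x.2, x.2⟩)
    (fun x => ⟨restrict (π.letters ∪ σ.letters) x.2, x.2⟩) ?_ ?_ ?_ ?_ ?_
  · rintro ⟨ρ, κ⟩ hx
    rw [Finset.mem_sigma] at hx ⊢
    exact ⟨(back hx.1 hx.2).1, (back hx.1 hx.2).2.1⟩
  · rintro ⟨ρ, κ⟩ hx
    rw [Finset.mem_sigma] at hx ⊢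
    exact ⟨(triple_aux h1 hx.1 hx.2).1, (triple_aux h1 hx.1 hx.2).2.1⟩
  · rintro ⟨ρ, κ⟩ hx
    rw [Finset.mem_sigma] at hx
    simp only [(back hx.1 hx.2).2.2]
  · rintro ⟨ρ, κ⟩ hx
    rw [Finset.mem_sigma] at hx
    simp only [(triple_aux h1 hx.1 hx.2).2.2]
  · intros; rfl

theorem mul_comm_aux (x y : CyclicShuffleAlgebra cst h) : x * y = y * x := by
  have : mulLin h = (mulLin h).flip := by
    refine (basis h).ext fun a => (basis h).ext fun b => ?_
    rw [LinearMap.flip_apply, ← mul_def, ← mul_def]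
    obtain ⟨⟨π, σ⟩, rfl, rfl, hd⟩ := cst.exists_disjoint_reps a b
    change cls h π * cls h σ = cls h σ * cls h π
    rw [cls_mul_cls _ _ hd, cls_mul_cls _ _ hd.symm, cyclicShuffles_comm]
  exact LinearMap.congr_fun₂ this x y

theorem one_mul_aux (x : CyclicShuffleAlgebra cst h) : 1 * x = x := by
  have : mulLin h 1 = LinearMap.id := by
    refine (basis h).ext fun a => ?_
    obtain ⟨σ, rfl⟩ := cst.exists_mkClass a
    change cls h (CyclicPerm.of [] List.nodup_nil) * cls h σ = cls h σ
    rw [cls_mul_cls (CyclicPerm.of [] List.nodup_nil) σ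
      (show Disjoint ∅ σ.letters from Finset.disjoint_empty_left _), cyclicShuffles_nil,
      Finset.sum_singleton]
  exact LinearMap.congr_fun this x

theorem add_mul_aux (x y z : CyclicShuffleAlgebra cst h) : (x + y) * z = x * z + y * z := by
  simp only [mul_def, map_add, LinearMap.add_apply]

theorem mul_add_aux (x y z : CyclicShuffleAlgebra cst h) : x * (y + z) = x * y + x * z := by
  simp only [mul_def, map_add]

theorem smul_mul_aux (c : ℚ) (x y : CyclicShuffleAlgebra cst h) : (c • x) * y = c • (x * y) := by
  simp only [mul_def, map_smul, LinearMap.smul_apply]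

theorem mul_smul_aux (c : ℚ) (x y : CyclicShuffleAlgebra cst h) : x * (c • y) = c • (x * y) := by
  simp only [mul_def, map_smul]

theorem zero_mul_aux (x : CyclicShuffleAlgebra cst h) : 0 * x = 0 := by
  simp only [mul_def, map_zero, LinearMap.zero_apply]

theorem mul_zero_aux (x : CyclicShuffleAlgebra cst h) : x * 0 = 0 := by
  simp only [mul_def, map_zero]

theorem induction_basis {P : CyclicShuffleAlgebra cst h → Prop} (x : CyclicShuffleAlgebra cst h)
    (hb : ∀ a, P (single h a)) (h0 : P 0) (hadd : ∀ x y, P x → P y → P (x + y))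
    (hsmul : ∀ (c : ℚ) x, P x → P (c • x)) : P x := by
  have hx : x ∈ Submodule.span ℚ (Set.range (basis h)) := by
    rw [(basis h).span_eq]; trivial
  induction hx using Submodule.span_induction with
  | mem x hx => obtain ⟨a, rfl⟩ := hx; exact hb a
  | zero => exact h0
  | add x y _ _ hx hy => exact hadd x y hx hy
  | smul c x _ hx => exact hsmul c x hx

theorem mul_assoc_aux (x y z : CyclicShuffleAlgebra cst h) : x * y * z = x * (y * z) := by
  induction x using induction_basis with
  | h0 => simp only [zero_mul_aux]
  | hadd x x' hx hx' => simp only [add_mul_aux, hx, hx']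
  | hsmul c x hx => simp only [smul_mul_aux, hx]
  | hb a =>
    induction y using induction_basis with
    | h0 => simp only [zero_mul_aux, mul_zero_aux]
    | hadd y y' hy hy' => simp only [add_mul_aux, mul_add_aux, hy, hy']
    | hsmul c y hy => simp only [smul_mul_aux, mul_smul_aux, hy]
    | hb b =>
      induction z using induction_basis with
      | h0 => simp only [mul_zero_aux]
      | hadd z z' hz hz' => simp only [mul_add_aux, hz, hz']
      | hsmul c z hz => simp only [mul_smul_aux, hz]
      | hb c =>
        obtain ⟨⟨π, σ⟩, rfl, rfl, hd⟩ := cst.exists_disjoint_reps a b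
        obtain ⟨τ, rfl, hd'⟩ := cst.exists_rep_disjoint c (π.letters ∪ σ.letters)
        exact cls_mul_assoc π σ τ hd hd'

instance : CommRing (CyclicShuffleAlgebra cst h) :=
  { (inferInstance : AddCommGroup (CyclicShuffleAlgebra cst h)),
    (inferInstance : Mul (CyclicShuffleAlgebra cst h)),
    (inferInstance : One (CyclicShuffleAlgebra cst h)) with
    left_distrib := mul_add_aux
    right_distrib := add_mul_aux
    zero_mul := zero_mul_aux
    mul_zero := mul_zero_aux
    mul_assoc := mul_assoc_aux
    one_mul := one_mul_aux
    mul_one := fun x => by rw [mul_comm_aux, one_mul_aux]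
    mul_comm := mul_comm_aux }

instance : Algebra ℚ (CyclicShuffleAlgebra cst h) :=
  Algebra.ofModule smul_mul_aux mul_smul_aux

/-- The `n`th homogeneous component: the span of the classes of cyclic permutations of length
`n`. -/
def homogeneousComponent (h : cst.IsCyclicShuffleCompatible) (n : ℕ) :
    Submodule ℚ (CyclicShuffleAlgebra cst h) :=
  Submodule.span ℚ {x | ∃ π : CyclicPerm, π.length = n ∧ x = cls h π}

end CyclicShuffleAlgebra

/-! ### The cyclic descent number -/

/-- The cyclic descent set of a linear permutation `π` of length `n`: the positions `i` with
`π_i > π_{i+1}`, where positions (here numbered from `0`) are read modulo `n`. -/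
def cDes (π : List ℕ+) : Finset (Fin π.length) :=
  Finset.univ.filter fun i =>
    π[((i : ℕ) + 1) % π.length]'(Nat.mod_lt _ (Nat.lt_of_le_of_lt (Nat.zero_le _) i.2)) < π[(i : ℕ)]

theorem card_cDes_rotate_le (π : List ℕ+) (k : ℕ) :
    (cDes (π.rotate k)).card ≤ (cDes π).card := by
  have hlt : ∀ i : Fin (π.rotate k).length, (i : ℕ) < π.length := fun i =>
    i.2.trans_eq (List.length_rotate ..)
  have hpos : ∀ i : Fin (π.rotate k).length, 0 < π.length := fun i =>
    Nat.lt_of_le_of_lt (Nat.zero_le _) (hlt i)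
  refine Finset.card_le_card_of_injOn
    (fun i => ⟨((i : ℕ) + k) % π.length, Nat.mod_lt _ (hpos i)⟩) ?_ ?_
  · intro i hi
    simp only [cDes, Finset.coe_filter, Finset.mem_univ, true_and, Set.mem_ofPred_eq,
      List.getElem_rotate, List.length_rotate] at hi ⊢
    convert hi using 2
    rw [Nat.mod_add_mod, Nat.mod_add_mod, add_right_comm]
  · intro i _ j _ hij
    simp only [Fin.mk.injEq] at hij
    have h1 : (i : ℕ) ≡ j [MOD π.length] := Nat.ModEq.add_right_cancel' k hij
    exact Fin.ext (Nat.ModEq.eq_of_lt_of_lt h1 (hlt i) (hlt j))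

theorem card_cDes_of_isRotated {π σ : List ℕ+} (h : π.IsRotated σ) :
    (cDes π).card = (cDes σ).card := by
  obtain ⟨m, hm⟩ := h.symm
  obtain ⟨k, rfl⟩ := h
  refine le_antisymm ?_ (card_cDes_rotate_le π k)
  have := card_cDes_rotate_le (π.rotate k) m
  rwa [hm] at this

theorem standardization_lt_iff {π : List ℕ+} {x y : ℕ+} (hx : x ∈ π) :
    π.countP (fun z => decide (z ≤ y)) < π.countP (fun z => decide (z ≤ x)) ↔ y < x := by
  constructor
  · intro h
    by_contra hxy
    rw [not_lt] at hxy
    refine absurd h (not_lt.2 (List.countP_mono_left fun z _ hz => ?_))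
    simp only [decide_eq_true_eq] at hz ⊢
    exact hz.trans hxy
  · intro h
    obtain ⟨a, b, rfl⟩ := List.append_of_mem hx
    have h1 : ∀ l : List ℕ+, l.countP (fun z => decide (z ≤ y)) ≤
        l.countP (fun z => decide (z ≤ x)) := fun l => List.countP_mono_left fun z _ hz => by
      simp only [decide_eq_true_eq] at hz ⊢
      exact hz.trans h.le
    have ha := h1 a
    have hb := h1 b
    simp only [List.countP_append, List.countP_cons, le_refl, decide_true, if_true, not_le.2 h,
      decide_false, Bool.false_eq_true, if_false]
    omega

theorem card_cDes_of_standardization {π σ : List ℕ+}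
    (h : standardization π = standardization σ) : (cDes π).card = (cDes σ).card := by
  have hl : π.length = σ.length := by simpa [standardization] using congrArg List.length h
  have hlt : ∀ i j (hi : i < π.length) (hj : j < π.length),
      π[i] < π[j] ↔ σ[i]'(hl ▸ hi) < σ[j]'(hl ▸ hj) := by
    intro i j hi hj
    have e : ∀ i (hi : i < π.length), π.countP (fun z => decide (z ≤ π[i])) =
        σ.countP (fun z => decide (z ≤ σ[i]'(hl ▸ hi))) := by
      intro i hi
      have := List.getElem_of_eq h (i := i) (by simpa [standardization] using hi)
      simpa [standardization] using this
    rw [← standardization_lt_iff (List.getElem_mem hj), e i hi, e j hj,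
      standardization_lt_iff (List.getElem_mem _)]
  refine Finset.card_bij (fun i _ => Fin.cast hl i) ?_ ?_ ?_
  · intro i hi
    simp only [cDes, Finset.mem_filter, Finset.mem_univ, true_and] at hi ⊢
    rw [hlt] at hi
    simpa [← hl] using hi
  · intro i _ j _ hij
    exact Fin.cast_injective hl hij
  · intro i hi
    refine ⟨Fin.cast hl.symm i, ?_, rfl⟩
    simp only [cDes, Finset.mem_filter, Finset.mem_univ, true_and] at hi ⊢
    rw [hlt]
    simpa [hl] using hi

/-- The cyclic descent number, `cdes [π] = |cDes π|`. -/
def cdes : CyclicStatistic ℕ where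
  toFun π := Quotient.lift (s := List.IsRotated.setoid ℕ+) (fun l => (cDes l).card)
    (fun _ _ h => card_cDes_of_isRotated h) π.1
  eq_of_same_order _ _ _ _ h := card_cDes_of_standardization h

theorem cdes_of (π : List ℕ+) (h : π.Nodup) : cdes (CyclicPerm.of π h) = (cDes π).card := rfl

/-! ### The target algebras -/

/-- The algebra `ℚ[[t*]]`: formal power series over `ℚ` with the Hadamard (coefficientwise)
product. -/
@[ext] structure HadamardSeries where
  ofPowerSeries ::
  toPowerSeries : PowerSeries ℚ

namespace HadamardSeries

/-- A power series is determined by its coefficients. -/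
def coeffEquiv : HadamardSeries ≃ (ℕ → ℚ) where
  toFun f n := PowerSeries.coeff n f.toPowerSeries
  invFun a := ⟨PowerSeries.mk a⟩
  left_inv f := by ext n; simp
  right_inv a := by funext n; simp

instance : CommRing HadamardSeries := coeffEquiv.commRing

instance : Algebra ℚ HadamardSeries := coeffEquiv.algebra ℚ

theorem coeff_mul (f g : HadamardSeries) (n : ℕ) :
    PowerSeries.coeff n (f * g).toPowerSeries =
      PowerSeries.coeff n f.toPowerSeries * PowerSeries.coeff n g.toPowerSeries :=
  congrFun (coeffEquiv.apply_symm_apply (coeffEquiv f * coeffEquiv g)) n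

theorem toPowerSeries_add (f g : HadamardSeries) :
    (f + g).toPowerSeries = f.toPowerSeries + g.toPowerSeries := by
  ext n
  exact congrFun (coeffEquiv.apply_symm_apply (coeffEquiv f + coeffEquiv g)) n

theorem toPowerSeries_smul (c : ℚ) (f : HadamardSeries) :
    (c • f).toPowerSeries = c • f.toPowerSeries := by
  ext n
  exact congrFun (coeffEquiv.apply_symm_apply (c • coeffEquiv f)) n

theorem toPowerSeries_one : (1 : HadamardSeries).toPowerSeries = (1 - PowerSeries.X)⁻¹ := by
  rw [PowerSeries.eq_inv_iff_mul_eq_one (by simp)]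
  exact PowerSeries.mk_one_mul_one_sub_eq_one ℚ

end HadamardSeries

/-- The element `(f / g) x ^ n` of `ℚ[[t*]][x]`; the quotient of power series (with `g` of nonzero
constant term) is taken with respect to the ordinary product of power series. -/
def seriesTerm (f g : PowerSeries ℚ) (n : ℕ) : Polynomial HadamardSeries :=
  Polynomial.monomial n (HadamardSeries.ofPowerSeries (f * g⁻¹))

/-- The element `(k t^k + (n - k) t^(k+1)) / (1 - t)^(n+1) x^n` of `ℚ[[t*]][x]`. -/
def cdesSeries (n k : ℕ) : Polynomial HadamardSeries :=
  seriesTerm ((k : PowerSeries ℚ) * PowerSeries.X ^ k +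
    ((n : PowerSeries ℚ) - (k : PowerSeries ℚ)) * PowerSeries.X ^ (k + 1))
    ((1 - PowerSeries.X) ^ (n + 1)) n

/-- The function `p ↦ C(p+n-k-1, n-1) p x^n` in `ℚ[x]^ℕ`, used for `k + 1 ≤ n`, where no
subtraction is truncated. -/
def cdesBinomial (n k : ℕ) : ℕ → Polynomial ℚ := fun p =>
  Polynomial.monomial n (((p + n - k - 1).choose (n - 1) : ℚ) * (p : ℚ))

end CyclicShuffle

end

open CyclicShuffle

noncomputable section

namespace CyclicShuffle

open Finset

/-! The proof counts labelings. Label the letters of a finite set `A` by `0, …, p - 1`, sort them by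
label with ties broken by the letters themselves, and read the sorted word cyclically. Each labeling
thus picks out one cyclic permutation with letter set `A`; let `L_π(p)` be the number of labelings
that pick out `[π]`.

If `A` and `B` are disjoint, a labeling of `A ∪ B` is a pair of labelings, and deleting letters from
a sorted word leaves a sorted word. Hence the cyclic word of the union is a cyclic shuffle of the
two cyclic words, and `L_π(p) L_σ(p)` is the sum of `L_τ(p)` over the shuffles `[τ]`
(`card_cyclicLabelings_mul`).

To compute `L_π(p)` with `n = |π| ≥ 1` and `k = cdes [π]`, split by the rotation of `π` that is the
sorted word. A word is sorted exactly by the labelings that increase weakly along it, and strictly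
at its descents; with `d` descents there are `C(p+n-1-d, n)` of them (`card_sortedLabelings`). Of
the `n` rotations, `k` have a descent from last letter to first, so `k - 1` linear descents; the
other `n - k` have `k`. Therefore `L_π(p) = k C(p+n-k, n) + (n-k) C(p+n-1-k, n) = C(p+n-k-1, n-1) p`
(`choose_identity`), which depends only on `n` and `k`.

For fixed `n` these functions are triangular in `k`, so the functions `L_π(p) x^n` of distinct
classes are linearly independent. The product `L_π L_σ` depends only on the two classes, and its
expansion in this family is unique, so the multiset of classes of shuffles is determined: this is
shuffle-compatibility. The same map then embeds the algebra in functions of `p`. The series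
realization has `L_π(p)` as its coefficients of `t^p`, so it follows by taking coefficients, an
injective homomorphism for the Hadamard product. The spans and dimensions come from the fact that
for `n ≥ 2` the values of `cdes` are exactly `1, …, n - 1`. -/

/-! ### Labelings of letters and the order they induce -/

/-- The order on letters comparing first the labels and then the letters themselves. -/
def LabelLE (f : ℕ+ → ℕ) (a b : ℕ+) : Prop := f a < f b ∨ (f a = f b ∧ a ≤ b)

instance (f : ℕ+ → ℕ) : DecidableRel (LabelLE f) := fun _ _ =>
  inferInstanceAs (Decidable (_ ∨ _))

instance (f : ℕ+ → ℕ) : IsTrans ℕ+ (LabelLE f) where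
  trans a b c h1 h2 := by
    unfold LabelLE at *
    rcases h1 with h1 | ⟨h1, h1'⟩ <;> rcases h2 with h2 | ⟨h2, h2'⟩
    · exact Or.inl (h1.trans h2)
    · exact Or.inl (h2 ▸ h1)
    · exact Or.inl (h1 ▸ h2)
    · exact Or.inr ⟨h1.trans h2, h1'.trans h2'⟩

instance (f : ℕ+ → ℕ) : Std.Antisymm (LabelLE f) where
  antisymm a b h1 h2 := by
    unfold LabelLE at *
    rcases h1 with h1 | ⟨h1, h1'⟩ <;> rcases h2 with h2 | ⟨h2, h2'⟩
    · omega
    · omega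
    · omega
    · exact le_antisymm h1' h2'

instance (f : ℕ+ → ℕ) : Std.Total (LabelLE f) where
  total a b := by
    unfold LabelLE
    rcases lt_trichotomy (f a) (f b) with h | h | h
    · exact Or.inl (Or.inl h)
    · rcases le_total a b with h' | h'
      · exact Or.inl (Or.inr ⟨h, h'⟩)
      · exact Or.inr (Or.inr ⟨h.symm, h'⟩)
    · exact Or.inr (Or.inl h)

theorem LabelLE.le {f : ℕ+ → ℕ} {a b : ℕ+} (h : LabelLE f a b) : f a ≤ f b :=
  h.elim le_of_lt fun h => h.1.le

theorem labelLE_congr {f g : ℕ+ → ℕ} {a b : ℕ+} (ha : f a = g a) (hb : f b = g b) :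
    LabelLE f a b ↔ LabelLE g a b := by
  unfold LabelLE
  rw [ha, hb]

open Classical in
/-- The labelings of the letters in `A` by `0, …, p - 1`, extended by `0` to all letters. -/
def labelings (A : Finset ℕ+) (p : ℕ) : Finset (ℕ+ → ℕ) :=
  (A.pi fun _ => range p).image fun g a => if h : a ∈ A then g a h else 0

theorem mem_labelings {A : Finset ℕ+} {p : ℕ} {f : ℕ+ → ℕ} :
    f ∈ labelings A p ↔ (∀ a ∈ A, f a < p) ∧ ∀ a ∉ A, f a = 0 := by
  classical
  simp only [labelings, Finset.mem_image, Finset.mem_pi, Finset.mem_range]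
  constructor
  · rintro ⟨g, hg, rfl⟩
    refine ⟨fun a ha => ?_, fun a ha => ?_⟩
    · simpa only [dif_pos ha] using hg a ha
    · simp only [dif_neg ha]
  · rintro ⟨h1, h2⟩
    refine ⟨fun a _ => f a, h1, ?_⟩
    funext a
    by_cases ha : a ∈ A
    · rw [dif_pos ha]
    · rw [dif_neg ha, h2 a ha]

/-- The labelings of the letters of `l` for which `l` lists its letters in increasing order. -/
def sortedLabelings (l : List ℕ+) (p : ℕ) : Finset (ℕ+ → ℕ) :=
  {f ∈ labelings l.toFinset p | l.Pairwise (LabelLE f)}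

theorem mem_sortedLabelings {l : List ℕ+} {p : ℕ} {f : ℕ+ → ℕ} :
    f ∈ sortedLabelings l p ↔
      (∀ a ∈ l, f a < p) ∧ (∀ a ∉ l, f a = 0) ∧ l.Pairwise (LabelLE f) := by
  simp only [sortedLabelings, Finset.mem_filter, mem_labelings, List.mem_toFinset, and_assoc]

theorem sortedLabelings_zero (l : List ℕ+) (a : ℕ+) : sortedLabelings (l ++ [a]) 0 = ∅ := by
  rw [Finset.eq_empty_iff_forall_notMem]
  intro f hf
  exact absurd ((mem_sortedLabelings.1 hf).1 a (by simp)) (Nat.not_lt_zero _)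

theorem card_sortedLabelings_singleton (a : ℕ+) (p : ℕ) : #(sortedLabelings [a] p) = p := by
  classical
  have : sortedLabelings [a] p = (range p).image fun v => Function.update (0 : ℕ+ → ℕ) a v := by
    ext f
    simp only [mem_sortedLabelings, List.mem_singleton, forall_eq, List.pairwise_singleton,
      and_true, Finset.mem_image, Finset.mem_range]
    constructor
    · rintro ⟨h1, h2⟩
      refine ⟨f a, h1, ?_⟩
      funext x
      by_cases hx : x = a
      · subst hx; simp
      · simp [hx, h2 x hx]
    · rintro ⟨v, hv, rfl⟩
      refine ⟨by simpa using hv, fun x hx => by simp [hx]⟩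
  rw [this, Finset.card_image_of_injective _ (Function.update_injective _ a), Finset.card_range]

/-- Labelings with labels at most `p` are split according to whether the last label is `p`. -/
theorem card_sortedLabelings_succ (l : List ℕ+) (a b : ℕ+) (hl : (l ++ [a] ++ [b]).Nodup) (p : ℕ) :
    #(sortedLabelings (l ++ [a] ++ [b]) (p + 1)) = #(sortedLabelings (l ++ [a] ++ [b]) p) +
      #(sortedLabelings (l ++ [a]) (p + if a < b then 1 else 0)) := by
  classical
  have hb : b ∉ l ++ [a] := fun h => (List.nodup_append.1 hl).2.2 b h b (by simp) rfl
  have hab : a ≠ b := fun h => hb (by simp [h])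
  -- Giving `b` the label `p` parametrizes the labelings whose last label is `p`; nothing is lost,
  -- since labelings of `l ++ [a]` vanish at `b`.
  have hinj : Set.InjOn (fun f : ℕ+ → ℕ => Function.update f b p)
      (sortedLabelings (l ++ [a]) (p + if a < b then 1 else 0)) := by
    intro f hf g hg hfg
    have hf' := (mem_sortedLabelings.1 hf).2.1 b hb
    have hg' := (mem_sortedLabelings.1 hg).2.1 b hb
    funext x
    by_cases hx : x = b
    · rw [hx, hf', hg']
    · simpa [hx] using congrFun hfg x
  rw [← Finset.card_image_of_injOn hinj, ← Finset.card_union_of_disjoint]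
  · congr 1
    ext f
    rw [Finset.mem_union, Finset.mem_image]
    constructor
    · intro hf
      obtain ⟨h1, h2, h3⟩ := mem_sortedLabelings.1 hf
      have h4 := List.pairwise_append.1 h3
      have h5 := List.pairwise_append.1 h4.1
      have hle : ∀ x ∈ l ++ [a], LabelLE f x a := by
        intro x hx
        rcases List.mem_append.1 hx with hx | hx
        · exact h5.2.2 x hx a (by simp)
        · rw [List.mem_singleton.1 hx]; exact Or.inr ⟨rfl, le_rfl⟩
      have hlb : LabelLE f a b := h4.2.2 a (by simp) b (by simp)
      -- Labels increase weakly along the word, so the last one bounds all of them.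
      by_cases hfb : f b < p
      · left
        refine mem_sortedLabelings.2 ⟨fun x hx => ?_, h2, h3⟩
        rcases List.mem_append.1 hx with hx | hx
        · exact ((h4.2.2 x hx b (by simp)).le).trans_lt hfb
        · rwa [List.mem_singleton.1 hx]
      · right
        have hfb' : f b = p := by
          have := h1 b (by simp)
          omega
        refine ⟨Function.update f b 0, mem_sortedLabelings.2 ⟨fun x hx => ?_, fun x hx => ?_, ?_⟩, ?_⟩
        · have hxb : x ≠ b := fun h => hb (h ▸ hx)
          rw [Function.update_of_ne hxb]
          have := (hle x hx).le
          -- With `f b = p`, the label of `a` may equal `p` only when `a < b`; this is the extra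
          -- label allowed on `l ++ [a]`.
          rcases hlb with h | ⟨h, h'⟩
          · omega
          · rw [if_pos (lt_of_le_of_ne h' hab)]; omega
        · by_cases hxb : x = b
          · rw [hxb, Function.update_self]
          · rw [Function.update_of_ne hxb]
            refine h2 x fun h => ?_
            rcases List.mem_append.1 h with h | h
            · exact hx h
            · exact hxb (List.mem_singleton.1 h)
        · refine h4.1.imp_of_mem fun {x y} hx hy h => (labelLE_congr ?_ ?_).1 h
          · rw [Function.update_of_ne (ne_of_mem_of_not_mem hx hb)]
          · rw [Function.update_of_ne (ne_of_mem_of_not_mem hy hb)]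
        · simp [← hfb']
    · rintro (hf | ⟨g, hg, rfl⟩)
      · obtain ⟨h1, h2, h3⟩ := mem_sortedLabelings.1 hf
        exact mem_sortedLabelings.2 ⟨fun x hx => (h1 x hx).trans (Nat.lt_succ_self p), h2, h3⟩
      · obtain ⟨h1, h2, h3⟩ := mem_sortedLabelings.1 hg
        have h5 := List.pairwise_append.1 h3
        have hle : ∀ x ∈ l ++ [a], LabelLE g x a := by
          intro x hx
          rcases List.mem_append.1 hx with hx | hx
          · exact h5.2.2 x hx a (by simp)
          · rw [List.mem_singleton.1 hx]; exact Or.inr ⟨rfl, le_rfl⟩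
        have hga := h1 a (by simp)
        have hlab : LabelLE (Function.update g b p) a b := by
          unfold LabelLE
          rw [Function.update_self, Function.update_of_ne hab]
          split_ifs at hga with h
          · rcases Nat.lt_succ_iff_lt_or_eq.1 hga with h' | h'
            · exact Or.inl h'
            · exact Or.inr ⟨h', h.le⟩
          · exact Or.inl hga
        have hne : ∀ x ∈ l ++ [a], Function.update g b p x = g x := fun x hx =>
          Function.update_of_ne (ne_of_mem_of_not_mem hx hb) _ _
        refine mem_sortedLabelings.2 ⟨fun x hx => ?_, fun x hx => ?_, ?_⟩
        · rcases List.mem_append.1 hx with hx | hx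
          · rw [hne x hx]
            have := h1 x hx
            split_ifs at this <;> omega
          · rw [List.mem_singleton.1 hx, Function.update_self]
            exact Nat.lt_succ_self p
        · rw [List.mem_append, not_or, List.mem_singleton] at hx
          rw [Function.update_of_ne hx.2]
          exact h2 x hx.1
        · refine List.pairwise_append.2 ⟨?_, List.pairwise_singleton _ _, ?_⟩
          · exact h3.imp_of_mem fun {x y} hx hy h => (labelLE_congr (hne x hx) (hne y hy)).2 h
          · intro x hx y hy
            rw [List.mem_singleton.1 hy]
            exact _root_.trans ((labelLE_congr (hne x hx) (hne a (by simp))).2 (hle x hx)) hlab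
  · rw [Finset.disjoint_left]
    intro f hf hf'
    obtain ⟨g, -, rfl⟩ := Finset.mem_image.1 hf'
    have := (mem_sortedLabelings.1 hf).1 b (by simp)
    simp at this

/-! ### Descents -/

/-- The number of descents of a list, without wrap-around. -/
def linearDescents (l : List ℕ+) : ℕ :=
  Nat.count (fun i => l.getD (i + 1) 1 < l.getD i 1) (l.length - 1)

theorem linearDescents_le (l : List ℕ+) : linearDescents l ≤ l.length - 1 := Nat.count_le _

theorem linearDescents_append (l : List ℕ+) (a b : ℕ+) :
    linearDescents (l ++ [a] ++ [b]) = linearDescents (l ++ [a]) + if b < a then 1 else 0 := by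
  have h1 : (l ++ [a] ++ [b]).length - 1 = l.length + 1 := by simp
  have h2 : (l ++ [a]).length - 1 = l.length := by simp
  rw [linearDescents, linearDescents, h1, h2, Nat.count_succ]
  congr 1
  · rw [Nat.count_eq_card_filter_range, Nat.count_eq_card_filter_range]
    congr 1
    refine Finset.filter_congr fun i hi => ?_
    rw [Finset.mem_range] at hi
    rw [List.getD_append (l ++ [a]) _ _ _ (by simp; omega),
      List.getD_append (l ++ [a]) _ _ _ (by simp; omega)]
  · congr 1
    rw [List.getD_append_right _ _ _ _ (by simp), List.getD_append _ _ _ l.length (by simp),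
      List.getD_append_right _ _ _ _ (by simp)]
    simp

/-- Double induction on the length and on `p`: splitting off the labelings whose last label is
maximal is Pascal's rule. Since at most `m` of the adjacent pairs are descents, the subtraction is
never truncated. -/
theorem card_sortedLabelings (m : ℕ) : ∀ (l : List ℕ+), l.Nodup → l.length = m + 1 → ∀ p : ℕ,
    #(sortedLabelings l p) = (p + m - linearDescents l).choose (m + 1) := by
  induction m with
  | zero =>
    intro l _ hlen p
    obtain ⟨a, rfl⟩ := List.length_eq_one_iff.1 hlen
    simp [card_sortedLabelings_singleton, linearDescents]
  | succ m ih =>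
    intro l hl hlen p
    obtain ⟨l', b, rfl⟩ : ∃ l' b, l = l' ++ [b] :=
      ⟨l.dropLast, l.getLast (by rintro rfl; simp at hlen), (List.dropLast_append_getLast _).symm⟩
    obtain ⟨l, a, rfl⟩ : ∃ l a, l' = l ++ [a] :=
      ⟨l'.dropLast, l'.getLast (by rintro rfl; simp at hlen), (List.dropLast_append_getLast _).symm⟩
    have hlen' : (l ++ [a]).length = m + 1 := by simpa using hlen
    have hd := linearDescents_le (l ++ [a])
    have hab : a ≠ b := fun h =>
      (List.nodup_append.1 hl).2.2 a (by simp) b (by simp) h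
    induction p with
    | zero =>
      rw [sortedLabelings_zero, Finset.card_empty, Nat.choose_eq_zero_of_lt (by omega)]
    | succ p ihp =>
      rw [card_sortedLabelings_succ l a b hl, ihp, ih _ (List.nodup_append.1 hl).1 hlen',
        linearDescents_append]
      rw [hlen'] at hd
      -- Appending `b` either creates no descent and allows one more label on the shorter word, or
      -- creates a descent and allows none: the upper index is the same either way.
      have e1 : p + (if a < b then 1 else 0) + m - linearDescents (l ++ [a]) =
          p + (m + 1) - (linearDescents (l ++ [a]) + if b < a then 1 else 0) := by
        rcases lt_or_gt_of_ne hab with h | h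
        · rw [if_pos h, if_neg h.not_gt]; omega
        · rw [if_neg h.not_gt, if_pos h]; omega
      have e2 : p + 1 + (m + 1) - (linearDescents (l ++ [a]) + if b < a then 1 else 0) =
          p + (m + 1) - (linearDescents (l ++ [a]) + if b < a then 1 else 0) + 1 := by
        split_ifs <;> omega
      rw [e1, e2, Nat.choose_succ_succ, add_comm]

/-- The reduction of `i` itself is redundant here, but makes the counted predicate periodic in `i`,
so that the count can be taken over any window of length `l.length`. The default value of `getD` is
never reached. -/
theorem card_cDes (l : List ℕ+) : #(cDes l) =
    Nat.count (fun i => l.getD ((i + 1) % l.length) 1 < l.getD (i % l.length) 1) l.length := by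
  rw [Nat.count_eq_card_filter_range, ← Finset.card_map Fin.valEmbedding]
  congr 1
  ext i
  simp only [cDes, Finset.mem_map, Finset.mem_filter, Finset.mem_univ, true_and,
    Fin.valEmbedding_apply, Finset.mem_range]
  constructor
  · rintro ⟨i, hi, rfl⟩
    refine ⟨i.2, ?_⟩
    rw [Nat.mod_eq_of_lt i.2, List.getD_eq_getElem _ _ i.2, List.getD_eq_getElem]
    exact hi
  · rintro ⟨hi, h⟩
    refine ⟨⟨i, hi⟩, ?_, rfl⟩
    rw [Nat.mod_eq_of_lt hi, List.getD_eq_getElem _ _ hi, List.getD_eq_getElem] at h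
    exact h

/-- The last letter of a rotation exceeds the first. -/
abbrev WrapDescent (l : List ℕ+) (r : ℕ) : Prop :=
  l.getD ((l.length - 1 + r + 1) % l.length) 1 < l.getD ((l.length - 1 + r) % l.length) 1

theorem getD_rotate (l : List ℕ+) (r i : ℕ) (hi : i < l.length) :
    (l.rotate r).getD i 1 = l.getD ((i + r) % l.length) 1 := by
  rw [List.getD_eq_getElem _ _ (by simpa using hi), List.getElem_rotate,
    List.getD_eq_getElem _ _ (Nat.mod_lt _ (by omega))]

/-- A rotation has the same cyclically adjacent pairs, and its linear descents overlook only the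
pair from last letter to first. -/
theorem card_cDes_eq_linearDescents_rotate (l : List ℕ+) (r : ℕ) (hl : l ≠ []) :
    #(cDes l) = linearDescents (l.rotate r) + if WrapDescent l r then 1 else 0 := by
  have hpos : 0 < l.length := List.length_pos_of_ne_nil hl
  obtain ⟨m, hm⟩ : ∃ m, l.length = m + 1 := ⟨l.length - 1, by omega⟩
  have hw : WrapDescent l r ↔ (l.rotate r).getD 0 1 < (l.rotate r).getD m 1 := by
    rw [WrapDescent, getD_rotate _ _ _ (by omega), getD_rotate _ _ _ (by omega), hm,
      Nat.add_sub_cancel, Nat.zero_add, show m + r + 1 = r + (m + 1) by ring, Nat.add_mod_right]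
  rw [if_congr hw rfl rfl, card_cDes_of_isRotated ⟨r, rfl⟩, card_cDes, linearDescents,
    List.length_rotate, hm, Nat.count_succ, Nat.add_sub_cancel, Nat.mod_self,
    Nat.mod_eq_of_lt (Nat.lt_succ_self m)]
  congr 1
  rw [Nat.count_eq_card_filter_range, Nat.count_eq_card_filter_range]
  congr 1
  refine Finset.filter_congr fun i hi => ?_
  rw [Finset.mem_range] at hi
  rw [Nat.mod_eq_of_lt (by omega : i + 1 < m + 1), Nat.mod_eq_of_lt (by omega : i < m + 1)]

/-- The last letter of the `r`-th rotation sits at cyclic position `l.length - 1 + r`, so the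
closing pairs of the rotations run through each cyclically adjacent pair once. -/
theorem card_wrapDescent (l : List ℕ+) :
    #{r ∈ range l.length | WrapDescent l r} = #(cDes l) := by
  rw [card_cDes]
  have hp : Function.Periodic
      (fun i => l.getD ((i + 1) % l.length) 1 < l.getD (i % l.length) 1) l.length := by
    intro i
    simp only
    rw [add_right_comm, Nat.add_mod_right, Nat.add_mod_right]
  rw [← Nat.filter_Ico_card_eq_of_periodic (l.length - 1) l.length _ hp]
  refine Finset.card_bij (fun r _ => l.length - 1 + r) ?_ ?_ ?_
  · intro r hr
    rw [Finset.mem_filter, Finset.mem_range] at hr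
    rw [Finset.mem_filter, Finset.mem_Ico]
    exact ⟨⟨by omega, by omega⟩, hr.2⟩
  · intros; omega
  · intro i hi
    rw [Finset.mem_filter, Finset.mem_Ico] at hi
    refine ⟨i - (l.length - 1), ?_, by omega⟩
    rw [Finset.mem_filter, Finset.mem_range]
    refine ⟨by omega, ?_⟩
    rw [WrapDescent, Nat.add_sub_cancel' hi.1.1]
    exact hi.2

/-- The sum over all rotations of the numbers of labelings they sort. -/
theorem sum_card_sortedLabelings_rotate (l : List ℕ+) (hl : l.Nodup) (hne : l ≠ []) (p : ℕ) :
    ∑ r ∈ range l.length, #(sortedLabelings (l.rotate r) p) =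
      #(cDes l) * (p + l.length - #(cDes l)).choose l.length +
      (l.length - #(cDes l)) * (p + l.length - 1 - #(cDes l)).choose l.length := by
  have hpos : 0 < l.length := List.length_pos_of_ne_nil hne
  have hterm : ∀ r ∈ range l.length, #(sortedLabelings (l.rotate r) p) =
      if WrapDescent l r then (p + l.length - #(cDes l)).choose l.length
      else (p + l.length - 1 - #(cDes l)).choose l.length := by
    intro r _
    have h := card_cDes_eq_linearDescents_rotate l r hne
    have hle := linearDescents_le (l.rotate r)
    rw [List.length_rotate] at hle
    rw [card_sortedLabelings (l.length - 1) _ (List.nodup_rotate.2 hl) (by simp; omega),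
      Nat.sub_add_cancel hpos]
    -- A closing descent is not linear, so the rotation has one linear descent fewer and the upper
    -- index is larger by one.
    split_ifs at h ⊢ with hw
    · congr 1; omega
    · congr 1; omega
  rw [Finset.sum_congr rfl hterm, Finset.sum_ite, Finset.sum_const, Finset.sum_const,
    card_wrapDescent, smul_eq_mul, smul_eq_mul]
  congr 2
  have := Finset.card_filter_add_card_filter_not (s := range l.length) (fun r => WrapDescent l r)
  rw [card_wrapDescent, Finset.card_range] at this
  omega

/-! ### Cyclic arrangements of labeled letters -/

/-- The letters of `A`, sorted by their labels, read cyclically. -/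
def arrange (f : ℕ+ → ℕ) (A : Finset ℕ+) : CyclicPerm :=
  CyclicPerm.of (A.sort (LabelLE f)) (A.sort_nodup _)

theorem sort_toFinset (f : ℕ+ → ℕ) (A : Finset ℕ+) : (A.sort (LabelLE f)).toFinset = A := by
  ext x
  rw [List.mem_toFinset, Finset.mem_sort]

theorem letters_arrange (f : ℕ+ → ℕ) (A : Finset ℕ+) : (arrange f A).letters = A :=
  sort_toFinset f A

theorem sort_eq_of_pairwise {f : ℕ+ → ℕ} {l : List ℕ+} {A : Finset ℕ+} (hnd : l.Nodup)
    (hA : l.toFinset = A) (hl : l.Pairwise (LabelLE f)) : A.sort (LabelLE f) = l := by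
  refine List.Perm.eq_of_pairwise (le := LabelLE f) (fun a b _ _ h1 h2 => antisymm h1 h2)
    (A.pairwise_sort _) hl ?_
  rw [List.perm_ext_iff_of_nodup (A.sort_nodup _) hnd]
  intro a
  rw [Finset.mem_sort, ← hA, List.mem_toFinset]

theorem arrange_congr {f g : ℕ+ → ℕ} {A : Finset ℕ+} (h : ∀ a ∈ A, f a = g a) :
    arrange f A = arrange g A := by
  apply Subtype.ext
  change ((A.sort (LabelLE f) : List ℕ+) : Cycle ℕ+) = (A.sort (LabelLE g) : List ℕ+)
  rw [sort_eq_of_pairwise (A.sort_nodup _) (sort_toFinset g A)]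
  exact (A.pairwise_sort (LabelLE g)).imp_of_mem fun {x y} hx hy hxy =>
    (labelLE_congr (h x ((Finset.mem_sort _).1 hx)) (h y ((Finset.mem_sort _).1 hy))).2 hxy

/-- A sublist of a sorted list is sorted, and `LabelLE f` admits only one sorted list of the letters
of `A`. -/
theorem restrictCycle_arrange (f : ℕ+ → ℕ) {A B : Finset ℕ+} (h : A ⊆ B) :
    restrictCycle A (arrange f B).1 = (arrange f A).1 := by
  change restrictCycle A ((B.sort (LabelLE f) : List ℕ+) : Cycle ℕ+) = (A.sort (LabelLE f) : List ℕ+)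
  rw [restrictCycle_coe]
  congr 1
  symm
  refine sort_eq_of_pairwise ((B.sort_nodup _).filter _) ?_ ((B.pairwise_sort _).filter _)
  ext x
  rw [List.mem_toFinset, List.mem_filter, Finset.mem_sort, decide_eq_true_eq]
  exact ⟨fun hx => hx.2, fun hx => ⟨h hx, hx⟩⟩

open Classical in
/-- The labelings of the letters of `π` whose cyclic arrangement is `π`. -/
def cyclicLabelings (π : CyclicPerm) (p : ℕ) : Finset (ℕ+ → ℕ) :=
  {f ∈ labelings π.letters p | arrange f π.letters = π}

theorem mem_cyclicLabelings {π : CyclicPerm} {p : ℕ} {f : ℕ+ → ℕ} :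
    f ∈ cyclicLabelings π p ↔ f ∈ labelings π.letters p ∧ arrange f π.letters = π := by
  rw [cyclicLabelings, Finset.mem_filter]

/-- Labelings vanish off their letter set, so a pair on disjoint sets is merged by addition and
recovered by `Set.indicator`. The shuffle counted is the arrangement of the merged labeling, whose
restrictions to the two sets are the given cyclic permutations. -/
theorem card_cyclicLabelings_mul (π σ : CyclicPerm) (hd : Disjoint π.letters σ.letters) (p : ℕ) :
    #(cyclicLabelings π p) * #(cyclicLabelings σ p) =
      ∑ τ ∈ cyclicShuffles π σ, #(cyclicLabelings τ p) := by
  classical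
  rw [← Finset.card_product, ← Finset.card_sigma]
  set A := π.letters with hA
  set B := σ.letters with hB
  have ind : ∀ (S : Finset ℕ+) (f : ℕ+ → ℕ), ∀ a ∈ S, Set.indicator (S : Set ℕ+) f a = f a :=
    fun S f a ha => Set.indicator_of_mem (Finset.mem_coe.2 ha) f
  have ind0 : ∀ (S : Finset ℕ+) (f : ℕ+ → ℕ), ∀ a ∉ S, Set.indicator (S : Set ℕ+) f a = 0 :=
    fun S f a ha => Set.indicator_of_notMem (fun h => ha (Finset.mem_coe.1 h)) f
  refine Finset.card_nbij' (fun x => ⟨arrange (x.1 + x.2) (A ∪ B), x.1 + x.2⟩)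
    (fun y => (Set.indicator A y.2, Set.indicator B y.2)) ?_ ?_ ?_ ?_
  · rintro ⟨f, g⟩ hx
    rw [Finset.mem_coe, Finset.mem_product, mem_cyclicLabelings, mem_cyclicLabelings,
      mem_labelings, mem_labelings] at hx
    obtain ⟨⟨⟨f1, f2⟩, f3⟩, ⟨g1, g2⟩, g3⟩ := hx
    simp only [← hA, ← hB] at f1 f2 f3 g1 g2 g3
    have hfA : ∀ a ∈ A, (f + g) a = f a := fun a ha => by
      simp [g2 a (Finset.disjoint_left.1 hd ha)]
    have hgB : ∀ a ∈ B, (f + g) a = g a := fun a ha => by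
      simp [f2 a (Finset.disjoint_right.1 hd ha)]
    simp only [Finset.mem_coe, Finset.mem_sigma, mem_cyclicShuffles, mem_cyclicLabelings,
      letters_arrange, mem_labelings]
    refine ⟨⟨hd, rfl, ?_, ?_⟩, ⟨fun a ha => ?_, fun a ha => ?_⟩, trivial⟩
    · rw [restrictCycle_arrange _ Finset.subset_union_left, arrange_congr hfA, f3]
    · rw [restrictCycle_arrange _ Finset.subset_union_right, arrange_congr hgB, g3]
    · rcases Finset.mem_union.1 ha with ha | ha
      · rw [hfA a ha]; exact f1 a ha
      · rw [hgB a ha]; exact g1 a ha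
    · rw [Finset.mem_union, not_or] at ha
      simp [f2 a ha.1, g2 a ha.2]
  · rintro ⟨τ, f⟩ hy
    rw [Finset.mem_coe, Finset.mem_sigma, mem_cyclicShuffles, mem_cyclicLabelings,
      mem_labelings] at hy
    obtain ⟨⟨-, hU, h1, h2⟩, ⟨f1, f2⟩, f3⟩ := hy
    simp only [← hA, ← hB] at hU h1 h2 f1 f2 f3
    rw [hU] at f1 f2 f3
    simp only [Finset.coe_product, Set.mem_prod, Finset.mem_coe, mem_cyclicLabelings, ← hA, ← hB,
      mem_labelings]
    refine ⟨⟨⟨fun a ha => ?_, ind0 A f⟩, ?_⟩, ⟨fun a ha => ?_, ind0 B f⟩, ?_⟩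
    · rw [ind A f a ha]; exact f1 a (Finset.mem_union_left _ ha)
    · rw [arrange_congr (ind A f)]
      apply Subtype.ext
      rw [← restrictCycle_arrange f (Finset.subset_union_left (s₁ := A) (s₂ := B)), f3, h1]
    · rw [ind B f a ha]; exact f1 a (Finset.mem_union_right _ ha)
    · rw [arrange_congr (ind B f)]
      apply Subtype.ext
      rw [← restrictCycle_arrange f (Finset.subset_union_right (s₁ := A) (s₂ := B)), f3, h2]
  · rintro ⟨f, g⟩ hx
    rw [Finset.mem_coe, Finset.mem_product, mem_cyclicLabelings, mem_cyclicLabelings,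
      mem_labelings, mem_labelings] at hx
    obtain ⟨⟨⟨f1, f2⟩, f3⟩, ⟨g1, g2⟩, g3⟩ := hx
    simp only [← hA, ← hB] at f1 f2 f3 g1 g2 g3
    refine Prod.ext ?_ ?_
    · funext a
      change Set.indicator (A : Set ℕ+) (f + g) a = f a
      by_cases ha : a ∈ A
      · rw [ind A _ a ha]; simp [g2 a (Finset.disjoint_left.1 hd ha)]
      · rw [ind0 A _ a ha]; exact (f2 a ha).symm
    · funext a
      change Set.indicator (B : Set ℕ+) (f + g) a = g a
      by_cases ha : a ∈ B
      · rw [ind B _ a ha]; simp [f2 a (Finset.disjoint_right.1 hd ha)]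
      · rw [ind0 B _ a ha]; exact (g2 a ha).symm
  · rintro ⟨τ, f⟩ hy
    rw [Finset.mem_coe, Finset.mem_sigma, mem_cyclicShuffles, mem_cyclicLabelings,
      mem_labelings] at hy
    obtain ⟨⟨-, hU, -, -⟩, ⟨-, f2⟩, f3⟩ := hy
    simp only [← hA, ← hB] at hU f2 f3
    rw [hU] at f2 f3
    have hf : Set.indicator (A : Set ℕ+) f + Set.indicator (B : Set ℕ+) f = f := by
      funext a
      rw [Pi.add_apply]
      by_cases ha : a ∈ A
      · rw [ind A _ a ha, ind0 B _ a (Finset.disjoint_left.1 hd ha), add_zero]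
      · by_cases hb : a ∈ B
        · rw [ind0 A _ a ha, ind B _ a hb, zero_add]
        · rw [ind0 A _ a ha, ind0 B _ a hb, f2 a (by simp [ha, hb])]
    simp only [hf, f3]

/-- The sorted word of such a labeling is a rotation of `l`; it is unique, and the rotations of a
nonempty word with distinct letters are distinct, so the union over rotations is disjoint. -/
theorem card_cyclicLabelings_of (l : List ℕ+) (hl : l.Nodup) (hne : l ≠ []) (p : ℕ) :
    #(cyclicLabelings (CyclicPerm.of l hl) p) =
      ∑ r ∈ range l.length, #(sortedLabelings (l.rotate r) p) := by
  classical
  rw [← Finset.card_biUnion]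
  · congr 1
    have hL : (CyclicPerm.of l hl).letters = l.toFinset := rfl
    ext f
    rw [mem_cyclicLabelings, Finset.mem_biUnion, hL]
    have key : ∀ r, f ∈ sortedLabelings (l.rotate r) p ↔
        f ∈ labelings l.toFinset p ∧ l.toFinset.sort (LabelLE f) = l.rotate r := by
      intro r
      have hr : (l.rotate r).toFinset = l.toFinset := by ext x; simp
      rw [sortedLabelings, Finset.mem_filter, hr]
      refine and_congr_right fun _ => ⟨fun h => ?_, fun h => ?_⟩
      · exact sort_eq_of_pairwise (List.nodup_rotate.2 hl) hr h
      · rw [← h]; exact Finset.pairwise_sort _ _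
    simp only [key]
    constructor
    · rintro ⟨h1, h2⟩
      have h3 : ((l.toFinset.sort (LabelLE f) : List ℕ+) : Cycle ℕ+) = (l : Cycle ℕ+) :=
        congrArg Subtype.val h2
      obtain ⟨r, hr⟩ := (Cycle.coe_eq_coe.1 h3).symm
      refine ⟨r % l.length, ?_, h1, ?_⟩
      · exact Finset.mem_range.2 (Nat.mod_lt _ (List.length_pos_of_ne_nil hne))
      · rw [List.rotate_mod, hr]
    · rintro ⟨r, -, h1, h2⟩
      refine ⟨h1, Subtype.ext ?_⟩
      change ((l.toFinset.sort (LabelLE f) : List ℕ+) : Cycle ℕ+) = (l : Cycle ℕ+)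
      rw [h2, Cycle.coe_eq_coe]
      exact List.IsRotated.symm ⟨r, rfl⟩
  · intro r hr s hs hrs
    rw [Function.onFun, Finset.disjoint_left]
    intro f hf hf'
    apply hrs
    have e1 := sort_eq_of_pairwise (A := l.toFinset) (List.nodup_rotate.2 hl) (by ext x; simp)
      (mem_sortedLabelings.1 hf).2.2
    have e2 := sort_eq_of_pairwise (A := l.toFinset) (List.nodup_rotate.2 hl) (by ext x; simp)
      (mem_sortedLabelings.1 hf').2.2
    have := List.Nodup.rotate_congr hl hne r s (e1.symm.trans e2)
    rwa [Nat.mod_eq_of_lt (Finset.mem_range.1 hr), Nat.mod_eq_of_lt (Finset.mem_range.1 hs)] at this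

/-! ### Values of the cyclic descent number -/

theorem CyclicPerm.exists_of (π : CyclicPerm) : ∃ l h, π = CyclicPerm.of l h := by
  obtain ⟨c, hc⟩ := π
  obtain ⟨l, rfl⟩ : ∃ l : List ℕ+, (l : Cycle ℕ+) = c := Quotient.exists_rep c
  exact ⟨l, hc, rfl⟩

theorem CyclicPerm.length_of (l : List ℕ+) (h : l.Nodup) : (CyclicPerm.of l h).length = l.length :=
  rfl

/-- In a word of at least two distinct letters, the cyclic successor of `x` is another letter.
Applied to the largest letter this gives a cyclic descent, to the smallest an ascent. -/
theorem exists_pos_step {l : List ℕ+} (hl : l.Nodup) (h2 : 2 ≤ l.length) (P : ℕ+ → ℕ+ → Prop)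
    (x : ℕ+) (hx : x ∈ l) (hP : ∀ y ∈ l, y ≠ x → P x y) :
    ∃ i : Fin l.length, P l[(i : ℕ)] (l[((i : ℕ) + 1) % l.length]'(Nat.mod_lt _ (by omega))) := by
  obtain ⟨i, hi, rfl⟩ := List.getElem_of_mem hx
  refine ⟨⟨i, hi⟩, hP _ (List.getElem_mem _) fun h => ?_⟩
  have := (List.Nodup.getElem_inj_iff hl).1 h
  simp only at this
  rcases Nat.lt_or_ge (i + 1) l.length with h' | h'
  · rw [Nat.mod_eq_of_lt h'] at this; omega
  · rw [show i + 1 = l.length by omega, Nat.mod_self] at this; omega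

theorem one_le_card_cDes {l : List ℕ+} (hl : l.Nodup) (h2 : 2 ≤ l.length) : 1 ≤ #(cDes l) := by
  have hne : l.toFinset.Nonempty := by
    rw [List.toFinset_nonempty_iff]; rintro rfl; simp at h2
  obtain ⟨x, hx, hmax⟩ := l.toFinset.exists_max_image id hne
  obtain ⟨i, hi⟩ := exists_pos_step hl h2 (fun a b => b < a) x (List.mem_toFinset.1 hx)
    fun y hy hyx => lt_of_le_of_ne (hmax y (List.mem_toFinset.2 hy)) hyx
  exact Finset.card_pos.2 ⟨i, by simpa [cDes] using hi⟩

theorem card_cDes_lt {l : List ℕ+} (hl : l.Nodup) (h2 : 2 ≤ l.length) : #(cDes l) < l.length := by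
  have hne : l.toFinset.Nonempty := by
    rw [List.toFinset_nonempty_iff]; rintro rfl; simp at h2
  obtain ⟨x, hx, hmin⟩ := l.toFinset.exists_min_image id hne
  obtain ⟨i, hi⟩ := exists_pos_step hl h2 (fun a b => a < b) x (List.mem_toFinset.1 hx)
    fun y hy hyx => lt_of_le_of_ne (hmin y (List.mem_toFinset.2 hy)) (Ne.symm hyx)
  have hi' : i ∉ cDes l := by simpa [cDes] using hi.le
  calc #(cDes l) < #(univ : Finset (Fin l.length)) :=
        Finset.card_lt_card ⟨Finset.subset_univ _, fun h => hi' (h (Finset.mem_univ i))⟩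
    _ = l.length := by simp

theorem card_cDes_of_length_le_one {l : List ℕ+} (h : l.length ≤ 1) : #(cDes l) = 0 := by
  rw [Finset.card_eq_zero, cDes, Finset.filter_eq_empty_iff]
  intro i _
  have hi := i.2
  have h1 : ((i : ℕ) + 1) % l.length = i := by
    rw [show (i : ℕ) + 1 = l.length by omega, Nat.mod_self]; omega
  simp only [h1, lt_irrefl, not_false_eq_true]

theorem cdes_eq_zero (π : CyclicPerm) (h : π.length ≤ 1) : cdes π = 0 := by
  obtain ⟨l, hl, rfl⟩ := π.exists_of
  exact card_cDes_of_length_le_one h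

theorem one_le_cdes (π : CyclicPerm) (h : 2 ≤ π.length) : 1 ≤ cdes π := by
  obtain ⟨l, hl, rfl⟩ := π.exists_of
  exact one_le_card_cDes hl h

theorem cdes_lt_length (π : CyclicPerm) (h : 1 ≤ π.length) : cdes π < π.length := by
  rcases Nat.lt_or_ge π.length 2 with h1 | h1
  · rw [cdes_eq_zero π (by omega)]; omega
  · obtain ⟨l, hl, rfl⟩ := π.exists_of
    exact card_cDes_lt hl h1

/-- Every value between `1` and `n - 1` is the cyclic descent number of some cyclic permutation of
length `n`. -/
theorem exists_length_cdes (n k : ℕ) (hk : 1 ≤ k) (hkn : k < n) :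
    ∃ π : CyclicPerm, π.length = n ∧ cdes π = k := by
  -- The word is `1, …, n-k, n+k, n+k-1, …, n+1`. Its cyclic descents start exactly at the last `k`
  -- positions, the final one being the step from `n+1` back to `1`.
  let g : ℕ → ℕ := fun i => if i < n - k then i + 1 else 2 * n - i
  have hg : ∀ i, i < n → 0 < g i := fun i hi => by simp only [g]; split_ifs <;> omega
  let f : ℕ → ℕ+ := fun i => (g i).toPNat'
  have hf : ∀ i, i < n → (f i : ℕ) = g i := fun i hi => by
    simp only [f, Nat.toPNat'_coe, hg i hi, if_true]
  have hnd : ((List.range n).map f).Nodup := by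
    refine List.Nodup.map_on (fun i hi j hj h => ?_) List.nodup_range
    rw [List.mem_range] at hi hj
    have h' := congrArg (fun x : ℕ+ => (x : ℕ)) h
    simp only [hf i hi, hf j hj, g] at h'
    split_ifs at h' <;> omega
  refine ⟨CyclicPerm.of _ hnd, by simp [CyclicPerm.length_of], ?_⟩
  rw [cdes_of, card_cDes, Nat.count_eq_card_filter_range, List.length_map, List.length_range]
  have : {i ∈ range n | ((List.range n).map f).getD ((i + 1) % n) 1 <
      ((List.range n).map f).getD (i % n) 1} = Finset.Ico (n - k) n := by
    ext i
    rw [Finset.mem_filter, Finset.mem_range, Finset.mem_Ico]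
    have hval : ∀ j, j < n → ((List.range n).map f).getD j 1 = f j := fun j hj => by
      rw [List.getD_eq_getElem _ _ (by simpa using hj)]; simp
    rw [and_comm (a := n - k ≤ i)]
    refine and_congr_right fun hi => ?_
    rw [Nat.mod_eq_of_lt hi, hval i hi, hval _ (Nat.mod_lt _ (by omega)), ← PNat.coe_lt_coe,
      hf i hi, hf _ (Nat.mod_lt _ (by omega))]
    rcases Nat.lt_or_ge (i + 1) n with h' | h'
    · rw [Nat.mod_eq_of_lt h']
      simp only [g]
      split_ifs <;> omega
    · rw [show i + 1 = n by omega, Nat.mod_self]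
      simp only [g]
      split_ifs <;> omega
  rw [this, Nat.card_Ico]
  omega

/-! ### The number of labelings of a cyclic permutation -/

/-- Put `N = p + n - k - 1`. Pascal's rule turns the left side into `k C(N, n-1) + n C(N, n)`, and
`n C(N, n) = (p - k) C(N, n-1)`. -/
theorem choose_identity (n k p : ℕ) (hn : 1 ≤ n) (hk : k < n) :
    (k : ℚ) * ((p + n - k).choose n : ℚ) + ((n : ℚ) - k) * ((p + n - 1 - k).choose n : ℚ) =
      ((p + n - k - 1).choose (n - 1) : ℚ) * p := by
  obtain ⟨m, rfl⟩ : ∃ m, n = m + 1 := ⟨n - 1, by omega⟩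
  obtain ⟨d, rfl⟩ : ∃ d, m = k + d := ⟨m - k, by omega⟩
  rw [show p + (k + d + 1) - k = p + d + 1 by omega,
    show p + (k + d + 1) - 1 - k = p + d by omega,
    show p + d + 1 - 1 = p + d by omega, Nat.add_sub_cancel, Nat.choose_succ_succ]
  have h := Nat.choose_succ_right_eq (p + d) (k + d)
  have h' : ((p + d).choose (k + d + 1) : ℚ) * (k + d + 1) =
      ((p + d).choose (k + d) : ℚ) * (p - k) := by
    -- For `p < k` the rational factor `p - k` is negative, unlike the truncated one in `h`, but
    -- both binomials vanish.
    rcases Nat.lt_or_ge (p + d) (k + d) with hlt | hge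
    · rw [Nat.choose_eq_zero_of_lt hlt, Nat.choose_eq_zero_of_lt (by omega)]; simp
    · have hq := congrArg (fun x : ℕ => (x : ℚ)) h
      simp only [Nat.cast_mul, Nat.cast_add, Nat.cast_one] at hq
      rw [Nat.cast_sub hge] at hq
      push_cast at hq
      linear_combination hq
  push_cast
  linear_combination h'

theorem card_cyclicLabelings (π : CyclicPerm) (h : 1 ≤ π.length) (p : ℕ) :
    (#(cyclicLabelings π p) : ℚ) =
      ((p + π.length - cdes π - 1).choose (π.length - 1) : ℚ) * p := by
  rw [← choose_identity _ _ _ h (cdes_lt_length π h)]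
  have hlt := cdes_lt_length π h
  obtain ⟨l, hl, rfl⟩ := π.exists_of
  have hne : l ≠ [] := by rintro rfl; simp [CyclicPerm.length_of] at h
  rw [card_cyclicLabelings_of l hl hne, sum_card_sortedLabelings_rotate l hl hne, ← cdes_of l hl,
    ← CyclicPerm.length_of l hl]
  push_cast [Nat.cast_sub hlt.le]
  ring

theorem card_cyclicLabelings_of_length_eq_zero (π : CyclicPerm) (h : π.length = 0) (p : ℕ) :
    #(cyclicLabelings π p) = 1 := by
  obtain ⟨l, hl, rfl⟩ := π.exists_of
  rw [CyclicPerm.length_of, List.length_eq_zero_iff] at h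
  subst h
  rw [Finset.card_eq_one]
  refine ⟨0, ?_⟩
  have hL : (CyclicPerm.of [] hl).letters = ∅ := rfl
  ext f
  rw [mem_cyclicLabelings, mem_labelings, hL, Finset.mem_singleton]
  constructor
  · rintro ⟨⟨-, h⟩, -⟩
    funext a
    exact h a (Finset.notMem_empty a)
  · rintro rfl
    refine ⟨⟨fun a ha => absurd ha (Finset.notMem_empty a), fun _ _ => rfl⟩, ?_⟩
    apply Subtype.ext
    change (((∅ : Finset ℕ+).sort (LabelLE 0) : List ℕ+) : Cycle ℕ+) = ([] : List ℕ+)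
    rw [sort_eq_of_pairwise hl List.toFinset_nil List.Pairwise.nil]

/-! ### Linear independence and shuffle-compatibility -/

/-- The function of `p` counting, in degree `|π|`, the labelings of `π` with `p` labels. -/
def labelingFunction (π : CyclicPerm) : ℕ → Polynomial ℚ := fun p =>
  Polynomial.monomial π.length (#(cyclicLabelings π p) : ℚ)

theorem labelingFunction_eq (π : CyclicPerm) :
    labelingFunction π = if 1 ≤ π.length then cdesBinomial π.length (cdes π) else 1 := by
  funext p
  split_ifs with h
  · rw [labelingFunction, card_cyclicLabelings π h, cdesBinomial]
  · have h0 : π.length = 0 := by omega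
    rw [labelingFunction, card_cyclicLabelings_of_length_eq_zero π h0, h0, Nat.cast_one]
    rfl

theorem labelingFunction_congr {π σ : CyclicPerm} (h : cdes π = cdes σ ∧ π.length = σ.length) :
    labelingFunction π = labelingFunction σ := by
  rw [labelingFunction_eq, labelingFunction_eq, h.1, h.2]

theorem labelingFunction_mul (π σ : CyclicPerm) (hd : Disjoint π.letters σ.letters) :
    labelingFunction π * labelingFunction σ =
      ∑ τ ∈ cyclicShuffles π σ, labelingFunction τ := by
  funext p
  rw [Pi.mul_apply, Finset.sum_apply]
  have : ∀ τ ∈ cyclicShuffles π σ, labelingFunction τ p =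
      Polynomial.monomial (π.length + σ.length) (#(cyclicLabelings τ p) : ℚ) := fun τ hτ => by
    rw [labelingFunction, CyclicShuffleAlgebra.length_of_mem hτ]
  rw [Finset.sum_congr rfl this, ← map_sum, labelingFunction, labelingFunction,
    Polynomial.monomial_mul_monomial]
  congr 1
  exact_mod_cast card_cyclicLabelings_mul π σ hd p

/-- The labeling function of an equivalence class. -/
def classFunction (a : cdes.EqClass) : ℕ → Polynomial ℚ :=
  Quotient.lift (s := cdes.setoid) labelingFunction (fun _ _ h => labelingFunction_congr h) a

theorem classFunction_mkClass (π : CyclicPerm) :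
    classFunction (cdes.mkClass π) = labelingFunction π := rfl

/-- The cyclic descent number of an equivalence class. -/
def classCdes (a : cdes.EqClass) : ℕ :=
  Quotient.lift (s := cdes.setoid) cdes (fun _ _ h => h.1) a

/-- At `p = cdes π` the binomial is `C(n-1, n-1)`. The maximum with `1` serves length one, where
`cdes π = 0` and the factor `p` would vanish. -/
theorem coeff_labelingFunction_ne_zero (π : CyclicPerm) :
    (labelingFunction π (max (cdes π) 1)).coeff π.length ≠ 0 := by
  rw [labelingFunction, Polynomial.coeff_monomial, if_pos rfl]
  rcases Nat.eq_zero_or_pos π.length with h | h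
  · rw [card_cyclicLabelings_of_length_eq_zero π h]; simp
  · rw [card_cyclicLabelings π h]
    have := cdes_lt_length π h
    have h1 : (max (cdes π) 1 + π.length - cdes π - 1).choose (π.length - 1) ≠ 0 :=
      (Nat.choose_pos (by omega)).ne'
    have h2 : max (cdes π) 1 ≠ 0 := by omega
    exact mul_ne_zero (Nat.cast_ne_zero.2 h1) (Nat.cast_ne_zero.2 h2)

/-- Different lengths give different degrees in `x`. For equal lengths `cdes σ` is strictly larger
than the evaluation point `p = cdes π`, and the upper index of the binomial drops below `n - 1`. -/
theorem coeff_labelingFunction_eq_zero {π σ : CyclicPerm} (hle : cdes π ≤ cdes σ)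
    (hne : ¬ (cdes σ = cdes π ∧ σ.length = π.length)) :
    (labelingFunction σ (max (cdes π) 1)).coeff π.length = 0 := by
  rw [labelingFunction, Polynomial.coeff_monomial]
  split_ifs with hl
  · have hlt : cdes π < cdes σ := lt_of_le_of_ne hle fun h => hne ⟨h.symm, hl⟩
    have h2 : 2 ≤ σ.length := by
      by_contra h
      rw [cdes_eq_zero σ (by omega)] at hlt
      omega
    have h1 := one_le_cdes π (hl ▸ h2)
    have h3 := cdes_lt_length σ (by omega)
    rw [card_cyclicLabelings σ (by omega), Nat.choose_eq_zero_of_lt (by omega)]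
    simp
  · rfl

/-- Triangularity: in a vanishing combination take a class of least `cdes` in the support and
evaluate at its own point and degree; only its own term survives. -/
theorem linearIndependent_classFunction : LinearIndependent ℚ classFunction := by
  rw [linearIndependent_iff]
  intro l hl
  by_contra h0
  obtain ⟨a, ha, hmin⟩ := l.support.exists_min_image classCdes
    (Finsupp.support_nonempty_iff.2 h0)
  obtain ⟨π, rfl⟩ := cdes.exists_mkClass a
  have h1 := congrArg (fun q : Polynomial ℚ => q.coeff π.length)
    (congrFun hl (max (cdes π) 1))
  simp only [Finsupp.linearCombination_apply, Finsupp.sum, Finset.sum_apply, Pi.smul_apply,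
    Polynomial.finsetSum_coeff, Polynomial.coeff_smul, Pi.zero_apply, Polynomial.coeff_zero,
    smul_eq_mul] at h1
  rw [Finset.sum_eq_single_of_mem _ ha] at h1
  · rcases mul_eq_zero.1 h1 with h2 | h2
    · exact Finsupp.mem_support_iff.1 ha h2
    · exact coeff_labelingFunction_ne_zero π h2
  · intro b hb hba
    obtain ⟨σ, rfl⟩ := cdes.exists_mkClass b
    rw [classFunction_mkClass, coeff_labelingFunction_eq_zero (hmin _ hb), mul_zero]
    exact fun h => hba (CyclicStatistic.mkClass_eq.2 h)

theorem cdes_isCyclicShuffleCompatible : cdes.IsCyclicShuffleCompatible := by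
  classical
  intro π π' σ σ' hd hd' h1 h2 h3 h4
  suffices h : (cyclicShuffles π σ).val.map cdes.mkClass =
      (cyclicShuffles π' σ').val.map cdes.mkClass by
    have h' := congrArg (Multiset.map classCdes) h
    rw [Multiset.map_map, Multiset.map_map] at h'
    exact h'
  -- Both multisets of classes become formal sums. Their images under the independent family are
  -- products of labeling functions, which agree because the factors depend only on classes.
  have key : ∑ τ ∈ cyclicShuffles π σ, Finsupp.single (cdes.mkClass τ) (1 : ℚ) =
      ∑ τ ∈ cyclicShuffles π' σ', Finsupp.single (cdes.mkClass τ) (1 : ℚ) := by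
    apply linearIndependent_classFunction
    simp only [map_sum, Finsupp.linearCombination_single, one_smul, classFunction_mkClass]
    rw [← labelingFunction_mul _ _ hd, ← labelingFunction_mul _ _ hd',
      labelingFunction_congr ⟨h1, h3⟩, labelingFunction_congr ⟨h2, h4⟩]
  ext a
  have ha := DFunLike.congr_fun key a
  -- The coefficient of a class is its multiplicity, cast to `ℚ`, where casting is injective.
  simp only [Finsupp.finsetSum_apply, Finsupp.single_apply, Finset.sum_boole] at ha
  rw [Multiset.count_map, Multiset.count_map]
  simp only [eq_comm (a := a)]
  exact_mod_cast ha

/-! ### Realizations of the cyclic shuffle algebra -/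

namespace CyclicShuffleAlgebra

variable {cst : CyclicStatistic α} {h : cst.IsCyclicShuffleCompatible} {B : Type*} [CommRing B]
  [Algebra ℚ B]

/-- Any two classes have disjoint representatives, so by bilinearity these cases suffice. -/
theorem map_mul_of_cls (f : CyclicShuffleAlgebra cst h →ₗ[ℚ] B)
    (hf : ∀ π σ : CyclicPerm, Disjoint π.letters σ.letters →
      f (cls h π * cls h σ) = f (cls h π) * f (cls h σ)) (x y : CyclicShuffleAlgebra cst h) :
    f (x * y) = f x * f y := by
  induction x using induction_basis with
  | h0 => simp only [zero_mul, map_zero]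
  | hadd x x' hx hx' => simp only [add_mul, map_add, hx, hx']
  | hsmul c x hx => simp only [smul_mul_assoc, map_smul, hx]
  | hb a =>
    induction y using induction_basis with
    | h0 => simp only [mul_zero, map_zero]
    | hadd y y' hy hy' => simp only [mul_add, map_add, hy, hy']
    | hsmul c y hy => simp only [mul_smul_comm, map_smul, hy]
    | hb b =>
      obtain ⟨⟨π, σ⟩, rfl, rfl, hd⟩ := cst.exists_disjoint_reps a b
      exact hf π σ hd

theorem span_range_cls : Submodule.span ℚ (Set.range (cls h)) = ⊤ := by
  rw [← (basis h).span_eq]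
  congr 1
  ext x
  constructor
  · rintro ⟨π, rfl⟩
    exact ⟨cst.mkClass π, rfl⟩
  · rintro ⟨a, rfl⟩
    obtain ⟨π, rfl⟩ := cst.exists_mkClass a
    exact ⟨π, rfl⟩

/-- An injective algebra homomorphism is an isomorphism onto the span of the images of the
classes. -/
theorem exists_algEquiv_span (φ : CyclicShuffleAlgebra cst h →ₐ[ℚ] B)
    (hφ : Function.Injective φ) (v : CyclicPerm → B) (hv : ∀ π, φ (cls h π) = v π) :
    ∃ (S : Subalgebra ℚ B) (e : CyclicShuffleAlgebra cst h ≃ₐ[ℚ] S),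
      Subalgebra.toSubmodule S = Submodule.span ℚ (Set.range v) ∧
      ∀ π : CyclicPerm, (e (cls h π) : B) = v π := by
  refine ⟨φ.range, AlgEquiv.ofInjective φ hφ, ?_, hv⟩
  have : Subalgebra.toSubmodule φ.range = Submodule.map φ.toLinearMap ⊤ := by
    ext x
    simp
  rw [this, ← span_range_cls, Submodule.map_span, ← Set.range_comp]
  congr 2
  funext π
  exact hv π

end CyclicShuffleAlgebra

open CyclicShuffleAlgebra

/-- The linear extension of `classFunction`. -/
def labelingLinearMap (h : cdes.IsCyclicShuffleCompatible) :
    CyclicShuffleAlgebra cdes h →ₗ[ℚ] (ℕ → Polynomial ℚ) :=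
  (basis h).constr ℚ classFunction

theorem labelingLinearMap_cls (h : cdes.IsCyclicShuffleCompatible) (π : CyclicPerm) :
    labelingLinearMap h (cls h π) = labelingFunction π :=
  (basis h).constr_basis ℚ classFunction (cdes.mkClass π)

theorem labelingLinearMap_injective (h : cdes.IsCyclicShuffleCompatible) :
    Function.Injective (labelingLinearMap h) := by
  have : labelingLinearMap h =
      (Finsupp.linearCombination ℚ classFunction).comp (basis h).repr.toLinearMap := by
    refine (basis h).ext fun a => ?_
    rw [labelingLinearMap, Module.Basis.constr_basis, LinearMap.comp_apply,
      LinearEquiv.coe_coe, Module.Basis.repr_self, Finsupp.linearCombination_single, one_smul]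
  rw [this]
  exact Function.Injective.comp linearIndependent_classFunction (basis h).repr.injective

/-- The realization of the cyclic shuffle algebra of `cdes` by functions of `p`. -/
def labelingAlgHom (h : cdes.IsCyclicShuffleCompatible) :
    CyclicShuffleAlgebra cdes h →ₐ[ℚ] (ℕ → Polynomial ℚ) :=
  AlgHom.ofLinearMap (labelingLinearMap h)
    (by
      rw [one_def, labelingLinearMap_cls, labelingFunction_eq, if_neg]
      simp [CyclicPerm.length_of])
    (map_mul_of_cls _ fun π σ hd => by
      rw [cls_mul_cls π σ hd, map_sum]
      simp only [labelingLinearMap_cls]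
      exact (labelingFunction_mul π σ hd).symm)

theorem labelingAlgHom_cls (h : cdes.IsCyclicShuffleCompatible) (π : CyclicPerm) :
    labelingAlgHom h (cls h π) = labelingFunction π := labelingLinearMap_cls h π

/-! ### Power series -/

/-- Taking the `p`-th coefficient is an algebra homomorphism for the Hadamard product. -/
def HadamardSeries.coeffAlgHom (p : ℕ) : HadamardSeries →ₐ[ℚ] ℚ :=
  (Pi.evalAlgHom ℚ (fun _ : ℕ => ℚ) p).comp (HadamardSeries.coeffEquiv.algEquiv ℚ).toAlgHom

/-- Taking the `p`-th coefficient of the power series coefficients of a polynomial, for all `p`. -/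
def coeffFunction : Polynomial HadamardSeries →ₐ[ℚ] (ℕ → Polynomial ℚ) :=
  AlgHom.pi fun p => Polynomial.mapAlgHom (HadamardSeries.coeffAlgHom p)

theorem coeffFunction_apply (F : Polynomial HadamardSeries) (p : ℕ) :
    coeffFunction F p = F.map (HadamardSeries.coeffAlgHom p : HadamardSeries →+* ℚ) := rfl

theorem coeffFunction_injective : Function.Injective coeffFunction := by
  intro F G hFG
  ext n : 1
  apply HadamardSeries.ext
  ext p
  have := congrArg (fun q : Polynomial ℚ => q.coeff n) (congrFun hFG p)
  simp only [coeffFunction_apply, Polynomial.coeff_map] at this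
  exact this

theorem coeffFunction_seriesTerm (f g : PowerSeries ℚ) (n p : ℕ) :
    coeffFunction (seriesTerm f g n) p =
      Polynomial.monomial n (PowerSeries.coeff p (f * g⁻¹)) := by
  rw [coeffFunction_apply, seriesTerm, Polynomial.map_monomial]
  rfl

theorem inv_one_sub_X_pow (n : ℕ) : ((1 - PowerSeries.X : PowerSeries ℚ) ^ (n + 1))⁻¹ =
    PowerSeries.mk fun i => ((n + i).choose n : ℚ) := by
  rw [← PowerSeries.mk_one_pow_eq_mk_choose_add, eq_comm,
    PowerSeries.eq_inv_iff_mul_eq_one (by simp), ← mul_pow,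
    PowerSeries.mk_one_mul_one_sub_eq_one, one_pow]

/-- For `p < k` the binomial has upper index below `n`. The bound on `k` prevents truncation, which
would give `C(0, 0) = 1` instead of `0` when `n = 0`. -/
theorem coeff_X_pow_mul_inv (n k p : ℕ) (hk : k ≤ p + n) :
    PowerSeries.coeff p ((PowerSeries.X : PowerSeries ℚ) ^ k *
      ((1 - PowerSeries.X) ^ (n + 1))⁻¹) = ((p + n - k).choose n : ℚ) := by
  rw [PowerSeries.coeff_X_pow_mul', inv_one_sub_X_pow, PowerSeries.coeff_mk]
  split_ifs with h
  · rw [show n + (p - k) = p + n - k by omega]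
  · rw [Nat.choose_eq_zero_of_lt (by omega), Nat.cast_zero]

/-- The two terms of the numerator yield the two binomial terms of `choose_identity`, that is, the
rotations with and without a closing descent. -/
theorem coeffFunction_cdesSeries (n k : ℕ) (hn : 1 ≤ n) (hk : k < n) :
    coeffFunction (cdesSeries n k) = cdesBinomial n k := by
  funext p
  rw [cdesSeries, coeffFunction_seriesTerm, cdesBinomial, ← choose_identity n k p hn hk]
  congr 1
  have e : ((n : PowerSeries ℚ) - (k : PowerSeries ℚ)) = PowerSeries.C ((n : ℚ) - k) := by simp
  have e' : (k : PowerSeries ℚ) = PowerSeries.C (k : ℚ) := by simp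
  rw [e, e', add_mul, mul_assoc, mul_assoc, map_add, PowerSeries.coeff_C_mul,
    PowerSeries.coeff_C_mul, coeff_X_pow_mul_inv _ _ _ (by omega),
    coeff_X_pow_mul_inv _ _ _ (by omega), show p + n - (k + 1) = p + n - 1 - k by omega]

/-- The element of `ℚ[[t*]][x]` attached to a cyclic permutation. -/
def cyclicSeries (π : CyclicPerm) : Polynomial HadamardSeries :=
  if 1 ≤ π.length then cdesSeries π.length (cdes π) else seriesTerm 1 (1 - PowerSeries.X) 0

theorem coeffFunction_cyclicSeries (π : CyclicPerm) :
    coeffFunction (cyclicSeries π) = labelingFunction π := by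
  rw [cyclicSeries, labelingFunction_eq]
  split_ifs with h
  · exact coeffFunction_cdesSeries _ _ h (cdes_lt_length π h)
  · funext p
    have := coeff_X_pow_mul_inv 0 0 p (by omega)
    rw [pow_zero, zero_add, pow_one] at this
    rw [coeffFunction_seriesTerm, this, Nat.choose_zero_right, Nat.cast_one]
    rfl

/-- The linear extension of `cyclicSeries`. -/
def seriesLinearMap (h : cdes.IsCyclicShuffleCompatible) :
    CyclicShuffleAlgebra cdes h →ₗ[ℚ] Polynomial HadamardSeries :=
  (basis h).constr ℚ (Quotient.lift (s := cdes.setoid) cyclicSeries fun π σ hπσ => by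
    rw [cyclicSeries, cyclicSeries, show cdes π = cdes σ from hπσ.1,
      show π.length = σ.length from hπσ.2])

theorem seriesLinearMap_cls (h : cdes.IsCyclicShuffleCompatible) (π : CyclicPerm) :
    seriesLinearMap h (cls h π) = cyclicSeries π :=
  (basis h).constr_basis ℚ _ (cdes.mkClass π)

theorem coeffFunction_seriesLinearMap (h : cdes.IsCyclicShuffleCompatible)
    (x : CyclicShuffleAlgebra cdes h) :
    coeffFunction (seriesLinearMap h x) = labelingAlgHom h x := by
  induction x using induction_basis with
  | h0 => simp only [map_zero]
  | hadd x x' hx hx' => simp only [map_add, hx, hx']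
  | hsmul c x hx => simp only [map_smul, hx]
  | hb a =>
    obtain ⟨π, rfl⟩ := cdes.exists_mkClass a
    change coeffFunction (seriesLinearMap h (cls h π)) = labelingAlgHom h (cls h π)
    rw [seriesLinearMap_cls, coeffFunction_cyclicSeries, labelingAlgHom_cls]

/-- The realization of the cyclic shuffle algebra of `cdes` by power series. -/
def seriesAlgHom (h : cdes.IsCyclicShuffleCompatible) :
    CyclicShuffleAlgebra cdes h →ₐ[ℚ] Polynomial HadamardSeries :=
  AlgHom.ofLinearMap (seriesLinearMap h)
    -- The unit and product laws are checked after the injective homomorphism `coeffFunction`, where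
    -- they are those of `labelingAlgHom`.
    (coeffFunction_injective (by rw [coeffFunction_seriesLinearMap, map_one, map_one]))
    (fun x y => coeffFunction_injective (by
      simp only [map_mul, coeffFunction_seriesLinearMap]))

theorem seriesAlgHom_injective (h : cdes.IsCyclicShuffleCompatible) :
    Function.Injective (seriesAlgHom h) := by
  intro x y hxy
  apply labelingLinearMap_injective h
  change labelingAlgHom h x = labelingAlgHom h y
  rw [← coeffFunction_seriesLinearMap, ← coeffFunction_seriesLinearMap]
  exact congrArg coeffFunction hxy

/-! ### Spanning sets and dimensions -/

/-- The values of a function of the length and the cyclic descent number. -/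
theorem range_length_cdes {β : Type*} (v : ℕ → ℕ → β) :
    Set.range (fun π : CyclicPerm => v π.length (cdes π)) =
      {v 0 0, v 1 0} ∪ {f | ∃ n k : ℕ, 2 ≤ n ∧ 1 ≤ k ∧ k ≤ n - 1 ∧ f = v n k} := by
  ext f
  constructor
  · rintro ⟨π, rfl⟩
    rcases Nat.lt_or_ge π.length 2 with h2 | h2
    · left
      dsimp only
      rw [cdes_eq_zero π (by omega)]
      rcases Nat.lt_or_ge π.length 1 with h1 | h1
      · left
        rw [show π.length = 0 by omega]
      · right
        rw [show π.length = 1 by omega]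
        rfl
    · right
      have := cdes_lt_length π (by omega)
      exact ⟨_, _, h2, one_le_cdes π h2, by omega, rfl⟩
  · rintro ((rfl | rfl) | ⟨n, k, h2, h1, hk, rfl⟩)
    · refine ⟨CyclicPerm.of [] List.nodup_nil, ?_⟩
      dsimp only
      rw [cdes_eq_zero (CyclicPerm.of [] List.nodup_nil) (Nat.zero_le 1)]
      rfl
    · refine ⟨CyclicPerm.of [1] (List.nodup_singleton 1), ?_⟩
      dsimp only
      rw [cdes_eq_zero (CyclicPerm.of [1] (List.nodup_singleton 1)) (le_refl 1)]
      rfl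
    · obtain ⟨π, rfl, rfl⟩ := exists_length_cdes n k h1 (by omega)
      exact ⟨π, rfl⟩

theorem range_cyclicSeries : Set.range cyclicSeries =
    {seriesTerm 1 (1 - PowerSeries.X) 0, seriesTerm PowerSeries.X ((1 - PowerSeries.X) ^ 2) 1} ∪
      {f | ∃ n k : ℕ, 2 ≤ n ∧ 1 ≤ k ∧ k ≤ n - 1 ∧ f = cdesSeries n k} := by
  have h := range_length_cdes fun n k =>
    if 1 ≤ n then cdesSeries n k else seriesTerm 1 (1 - PowerSeries.X) 0
  have h1 : cdesSeries 1 0 = seriesTerm PowerSeries.X ((1 - PowerSeries.X) ^ 2) 1 := by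
    simp [cdesSeries]
  simp only [le_refl, if_true, h1] at h
  refine h.trans ?_
  congr 1
  ext f
  refine exists_congr fun n => exists_congr fun k => and_congr_right fun hn => ?_
  rw [if_pos (by omega)]

theorem range_labelingFunction : Set.range labelingFunction =
    {1, fun p : ℕ => Polynomial.monomial 1 (p : ℚ)} ∪
      {f | ∃ n k : ℕ, 2 ≤ n ∧ 1 ≤ k ∧ k ≤ n - 1 ∧ f = cdesBinomial n k} := by
  have h := range_length_cdes fun n k => if 1 ≤ n then cdesBinomial n k else 1
  have h1 : cdesBinomial 1 0 = fun p : ℕ => Polynomial.monomial 1 (p : ℚ) := by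
    funext p
    simp [cdesBinomial]
  simp only [le_refl, if_true, h1, ← labelingFunction_eq] at h
  refine h.trans ?_
  congr 1
  ext f
  refine exists_congr fun n => exists_congr fun k => and_congr_right fun hn => ?_
  rw [if_pos (by omega)]

theorem finrank_homogeneousComponent (h : cdes.IsCyclicShuffleCompatible) (n : ℕ) (hn : 2 ≤ n) :
    Module.finrank ℚ (homogeneousComponent h n) = n - 1 := by
  -- One representative for each value `1, …, n - 1` of `cdes`, hence the shift by one; these
  -- exhaust the classes of length `n`.
  have hex : ∀ i : Fin (n - 1), ∃ π : CyclicPerm, π.length = n ∧ cdes π = i + 1 := fun i =>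
    exists_length_cdes n (i + 1) (by omega) (by omega)
  choose ρ hρ using hex
  have hinj : Function.Injective fun i => cdes.mkClass (ρ i) := by
    intro i j hij
    have := (CyclicStatistic.mkClass_eq.1 hij).1
    rw [(hρ i).2, (hρ j).2] at this
    exact Fin.ext (by omega)
  have hli : LinearIndependent ℚ fun i => cls h (ρ i) :=
    (basis h).linearIndependent.comp _ hinj
  have hset : {x | ∃ π : CyclicPerm, π.length = n ∧ x = cls h π} =
      Set.range fun i => cls h (ρ i) := by
    ext x
    constructor
    · rintro ⟨π, hπ, rfl⟩
      have h1 := one_le_cdes π (by omega)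
      have h2 := cdes_lt_length π (by omega)
      refine ⟨⟨cdes π - 1, by omega⟩, ?_⟩
      refine congrArg (single h) (CyclicStatistic.mkClass_eq.2 ⟨?_, ?_⟩)
      · rw [(hρ _).2]; exact Nat.sub_add_cancel h1
      · rw [(hρ _).1, hπ]
    · rintro ⟨i, rfl⟩
      exact ⟨ρ i, (hρ i).1, rfl⟩
  rw [homogeneousComponent, hset, finrank_span_eq_card hli, Fintype.card_fin]

end CyclicShuffle

end

open CyclicShuffle
theorem theorem4p8 :
    ∃ h : cdes.IsCyclicShuffleCompatible,
      (∃ (S : Subalgebra ℚ (Polynomial HadamardSeries)) (e : CyclicShuffleAlgebra cdes h ≃ₐ[ℚ] S),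
        Subalgebra.toSubmodule S = Submodule.span ℚ
          ({seriesTerm 1 (1 - PowerSeries.X) 0,
            seriesTerm PowerSeries.X ((1 - PowerSeries.X) ^ 2) 1} ∪
            {f | ∃ n k : ℕ, 2 ≤ n ∧ 1 ≤ k ∧ k ≤ n - 1 ∧ f = cdesSeries n k}) ∧
        ∀ π : CyclicPerm, (e (CyclicShuffleAlgebra.cls h π) : Polynomial HadamardSeries) =
          if 1 ≤ π.length then cdesSeries π.length (cdes π)
          else seriesTerm 1 (1 - PowerSeries.X) 0) ∧
      (∃ (S : Subalgebra ℚ (ℕ → Polynomial ℚ)) (e : CyclicShuffleAlgebra cdes h ≃ₐ[ℚ] S),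
        Subalgebra.toSubmodule S = Submodule.span ℚ
          ({1, fun p : ℕ => Polynomial.monomial 1 (p : ℚ)} ∪
            {f | ∃ n k : ℕ, 2 ≤ n ∧ 1 ≤ k ∧ k ≤ n - 1 ∧ f = cdesBinomial n k}) ∧
        ∀ π : CyclicPerm, (e (CyclicShuffleAlgebra.cls h π) : ℕ → Polynomial ℚ) =
          if 1 ≤ π.length then cdesBinomial π.length (cdes π) else 1) ∧
      ∀ n : ℕ, 2 ≤ n →
        Module.finrank ℚ (CyclicShuffleAlgebra.homogeneousComponent h n) = n - 1 := by
  have h := cdes_isCyclicShuffleCompatible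
  refine ⟨h, ?_, ?_, finrank_homogeneousComponent h⟩
  · rw [← range_cyclicSeries]
    exact CyclicShuffleAlgebra.exists_algEquiv_span (seriesAlgHom h) (seriesAlgHom_injective h)
      cyclicSeries (seriesLinearMap_cls h)
  · simp only [← range_labelingFunction, ← labelingFunction_eq]
    exact CyclicShuffleAlgebra.exists_algEquiv_span (labelingAlgHom h)
      (labelingLinearMap_injective h) labelingFunction (labelingAlgHom_cls h)
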